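/- \textbf{Setting.} Let $A\subset\mathbb R$ be a measurable set with $A=-A$ (bounded or unbounded), and write $dx$ for a reference measure on $\mathbb R$ invariant under $x\mapsto -x$ (Lebesgue measure for continuous outcomes, counting measure for discrete ones). A function $f:A\times\mathbb R\to[0,\infty)$ is \emph{valid} if $\int_A f(x;y)\,dx=1$ for all $y$; $f(x;y)=f(-x;-y)$; for every $x\in A$ with $x<0$ the function $y\mapsto f(x;y)$ is nonincreasing and tends to $0$ as $y\to\infty$; and $\sup_{y\in\mathbb R} f(x;y)<\infty$ for each fixed $x\in A$. It is \emph{strictly log-concave} in $y$ if $f>0$, $\log f(x;\cdot)$ is twice differentiable, and $\partial_y^2\log f(x;y)<0$ for all $x\in A$, $y\in\mathbb R$. Put $g(x;y)=\partial_y\log f(x;y)$ and $g_2=\partial_y g$, and let $X_y$ be a random variable with density $f(\cdot;y)$. Fix an integer $T\ge1$. For each $n$ let $p_n\in[0,1]$ and let $\mathbf u=\mathbf u^{(n)}\in\mathbb R^n$ be the true score vector, with $u_1=0$; assume that for some constant $c>1$, $p_n\ge c\,n^{-1}\log n$ for all large $n$. For $1\le i<j\le n$, the pair $(i,j)$ is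 compared $n_{ij}\sim\mathrm{Bin}(T,p_n)$ times, with outcomes $X_{ij}^{(t)}$, $t\le n_{ij}$, of density $f(\cdot;u_i-u_j)$; for each $n$ all the counts and outcomes are independent, and the data for all $n$ are defined on one probability space. The MLE $\hat{\mathbf u}$ is the maximizer of \[ l(\mathbf v)=\sum_{1\le i<j\le n}\ \sum_{t\le n_{ij}}\log f\big(X_{ij}^{(t)};v_i-v_j\big)\qquad\text{over } \{\mathbf v\in\mathbb R^n: v_1=0\}. \] Let $M_n=\max_{i,j}|u_i-u_j|$ and \[ C_n^{(1)}=\int_{A\cap[0,\infty)}f(x;M_n)\,dx,\qquad C_n^{(3)}=\sup_{x\in A,\,|y|\le M_n+1}|g_2(x;y)|,\qquad C_n^{(4)}=\inf_{x\in A,\,|y|\le M_n+1}|g_2(x;y)|. \] \textbf{Theorem (uniform consistency of the MLE, general case).} Suppose that $f$ is valid and strictly log-concave in $y$, and that there are finite constants $C_n^{(5)}\ge 0$ with \[ \sup_{|y|\le M_n}\|g(X_y;y)\|_{\psi_2}\le C_n^{(5)},\qquad \|Z\|_{\psi_2}=\inf\{t>0:\mathbb E\,e^{Z^2/t^2}\le2\}.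 \] Suppose that, as $n\to\infty$, \[ \Delta_n:=\frac{C_n^{(3)}C_n^{(5)}}{(C_n^{(4)})^2}\sqrt{\frac{\log n}{np_n}}\;\frac{\log n}{\log(np_n)}\to0 \qquad\text{and}\qquad \frac{\log n}{np_n\,|\log C_n^{(1)}|}\to0, \] where $\Delta_n=\infty$ if $C_n^{(3)}=\infty$ or $C_n^{(4)}=0$. Then there is a constant $K$ independent of $n$ such that, for all sufficiently large $n$, with probability at least $1-14n^{-2}$ the MLE $\hat{\mathbf u}$ uniquely exists and \[ \|\hat{\mathbf u}-\mathbf u\|_\infty\le K\,\Delta_n. \] In particular, $\hat{\mathbf u}$ is a uniformly consistent estimator of $\mathbf u$: almost surely, $\hat{\mathbf u}$ uniquely exists for all but finitely many $n$ and $\|\hat{\mathbf u}-\mathbf u\|_\infty\to0$. -/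

import Mathlib

open MeasureTheory ProbabilityTheory Filter Topology
open scoped ENNReal NNReal

noncomputable section

namespace PairwiseComparison

/-- A valid link function `f` on `A × ℝ`. Densities are taken with respect to a reflection-invariant
reference measure `ν` on `ℝ` (Lebesgue measure for continuous outcomes, counting measure for
discrete ones). Only the values `f x y` with `x ∈ A` matter. -/
structure IsValid (ν : Measure ℝ) (A : Set ℝ) (f : ℝ → ℝ → ℝ) : Prop where
  measurableSet : MeasurableSet A
  neg_mem : ∀ x ∈ A, -x ∈ A
  map_neg : ν.map (fun x => -x) = ν
  nonneg : ∀ x ∈ A, ∀ y, 0 ≤ f x y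
  integral_eq_one : ∀ y, ∫ x in A, f x y ∂ν = 1
  even : ∀ x ∈ A, ∀ y, f x y = f (-x) (-y)
  antitone : ∀ x ∈ A, x < 0 → Antitone (f x)
  tendsto_zero : ∀ x ∈ A, x < 0 → Tendsto (f x) atTop (𝓝 0)
  bddAbove : ∀ x ∈ A, BddAbove (Set.range (f x))

/-- The score `g(x; y) = ∂/∂y log f(x; y)`. -/
def score (f : ℝ → ℝ → ℝ) (x y : ℝ) : ℝ := deriv (fun z => Real.log (f x z)) y

/-- The derivative `g₂(x; y) = ∂/∂y g(x; y)` of the score. -/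
def scoreDeriv (f : ℝ → ℝ → ℝ) (x y : ℝ) : ℝ := deriv (score f x) y

/-- `f` is positive, `log f(x; ·)` is twice differentiable, and its second derivative is negative. -/
structure StrictlyLogConcave (A : Set ℝ) (f : ℝ → ℝ → ℝ) : Prop where
  pos : ∀ x ∈ A, ∀ y, 0 < f x y
  differentiable_log : ∀ x ∈ A, Differentiable ℝ (fun y => Real.log (f x y))
  differentiable_score : ∀ x ∈ A, Differentiable ℝ (score f x)
  scoreDeriv_neg : ∀ x ∈ A, ∀ y, scoreDeriv f x y < 0

/-- The law of the outcome `X_y` of a comparison with relative score `y`. -/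
def outcomeLaw (ν : Measure ℝ) (A : Set ℝ) (f : ℝ → ℝ → ℝ) (y : ℝ) : Measure ℝ :=
  (ν.restrict A).withDensity (fun x => ENNReal.ofReal (f x y))

/-- The `ψ₂`-norm of `h(X)` when `X` has law `Q`; it is `∞` when `h(X)` is not sub-Gaussian. -/
def psi2Norm (Q : Measure ℝ) (h : ℝ → ℝ) : ℝ≥0∞ :=
  ⨅ (t : ℝ) (_ : 0 < t) (_ : ∫⁻ x, ENNReal.ofReal (Real.exp (h x ^ 2 / t ^ 2)) ∂Q ≤ 2),
    ENNReal.ofReal t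

/-- The dynamic range `M = max_{i,j} |u_i - u_j|`. -/
def dynamicRange {n : ℕ} (u : Fin n → ℝ) : ℝ := ⨆ i, ⨆ j, |u i - u j|

/-- The global discrepancy `C⁽¹⁾`, at dynamic range `M`. -/
def C1 (ν : Measure ℝ) (A : Set ℝ) (f : ℝ → ℝ → ℝ) (M : ℝ) : ℝ :=
  ∫ x in A ∩ Set.Ici 0, f x M ∂ν

/-- `C⁽³⁾ = sup |g₂(x; y)|` over `x ∈ A`, `|y| ≤ M + 1`, possibly infinite. -/
def C3 (A : Set ℝ) (f : ℝ → ℝ → ℝ) (M : ℝ) : ℝ≥0∞ :=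
  ⨆ x ∈ A, ⨆ (y : ℝ) (_ : |y| ≤ M + 1), ENNReal.ofReal |scoreDeriv f x y|

/-- `C⁽⁴⁾ = inf |g₂(x; y)|` over `x ∈ A`, `|y| ≤ M + 1`. -/
def C4 (A : Set ℝ) (f : ℝ → ℝ → ℝ) (M : ℝ) : ℝ≥0∞ :=
  ⨅ x ∈ A, ⨅ (y : ℝ) (_ : |y| ≤ M + 1), ENNReal.ofReal |scoreDeriv f x y|

/-- The rate `Δ`, for `n` subjects, dynamic range `M`, comparison rate `p` and sub-Gaussian
constant `c5`. It is computed in `[0, ∞]`. -/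
def Delta (A : Set ℝ) (f : ℝ → ℝ → ℝ) (n : ℕ) (M p : ℝ) (c5 : ℝ≥0) : ℝ≥0∞ :=
  C3 A f M * c5 / C4 A f M ^ 2 *
    ENNReal.ofReal (√(Real.log n / (n * p)) * (Real.log n / Real.log (n * p)))

/-- The unordered pairs of distinct subjects, written as `(i, j)` with `i < j`. -/
abbrev Pair (n : ℕ) : Type := {e : Fin n × Fin n // e.1 < e.2}

/-- The comparison data of `n` subjects with latent scores `u`: each pair `e = (i, j)`, `i < j`, is
compared `N e ∼ Bin(T, p)` times, the outcome of its comparison number `t` is `X e t`, with density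
`f(·; u_i - u_j)`, and all these variables are independent. The outcomes `X e t` with `t < N e`
are the observed ones. -/
structure IsComparisonData {Ω : Type*} [MeasurableSpace Ω] (P : Measure Ω)
    (ν : Measure ℝ) (A : Set ℝ) (f : ℝ → ℝ → ℝ) (T : ℕ) (p : ℝ) {n : ℕ} (u : Fin n → ℝ)
    (N : Pair n → Ω → ℕ) (X : Pair n → Fin T → Ω → ℝ) : Prop where
  measurable_count : ∀ e, Measurable (N e)
  measurable_outcome : ∀ e t, Measurable (X e t)
  count_law : ∀ e k, P {ω | N e ω = k} =
    ENNReal.ofReal ((T.choose k : ℝ) * p ^ k * (1 - p) ^ (T - k))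
  outcome_law : ∀ e t, P.map (X e t) = outcomeLaw ν A f (u e.1.1 - u e.1.2)
  indep : iIndepFun (fun (k : Pair n × Option (Fin T)) (ω : Ω) =>
    k.2.elim (N k.1 ω : ℝ) (fun t => X k.1 t ω)) P

/-- The conditional log-likelihood of `v`, given the numbers `N e` of comparisons and the outcomes
`X e t`, `t < N e`. -/
def logLikelihood (f : ℝ → ℝ → ℝ) {T n : ℕ} (N : Pair n → ℕ) (X : Pair n → Fin T → ℝ)
    (v : Fin n → ℝ) : ℝ :=
  ∑ e : Pair n, ∑ t : Fin T with t.val < N e, Real.log (f (X e t) (v e.1.1 - v e.1.2))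

/-- The parameter space: the score of the first subject is `0`. -/
def paramSpace (n : ℕ) : Set (Fin n → ℝ) := {v | ∀ i : Fin n, (i : ℕ) = 0 → v i = 0}

/-- `v` is a maximum likelihood estimator: it maximizes `l` over the parameter space. -/
def IsMLE (f : ℝ → ℝ → ℝ) {T n : ℕ} (N : Pair n → ℕ) (X : Pair n → Fin T → ℝ)
    (v : Fin n → ℝ) : Prop :=
  v ∈ paramSpace n ∧ IsMaxOn (logLikelihood f N X) (paramSpace n) v

/-- `v` is the unique maximum likelihood estimator. -/
def IsUniqueMLE (f : ℝ → ℝ → ℝ) {T n : ℕ} (N : Pair n → ℕ) (X : Pair n → Fin T → ℝ)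
    (v : Fin n → ℝ) : Prop :=
  IsMLE f N X v ∧ ∀ w, IsMLE f N X w → w = v

end PairwiseComparison

end

open PairwiseComparison

/-! The likelihood is first maximized over `nearSpace u`, where the error d = v - u oscillates by at
most 1. There every difference v_i - v_j has absolute value at most M + 1, so the curvature bound
|g₂| ≥ c = C⁽⁴⁾ applies. If the constrained maximizer has oscillation strictly below 1, concavity
makes it a global maximizer, and strict concavity along the edges of a connected comparison graph
makes it unique (`isUniqueMLE_of_isMaxOn_nearSpace`).

To bound the oscillation, let U be an upper level set of d. Lowering v on U is an admissible move,
which gives a first order condition. With the curvature it shows that c times the total drop of d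
along the comparisons leaving U is at most the score at u summed over U, hence at most |U|B if each
coordinate of that gradient is at most B (`sum_cutSign_le_scoreSum`). Suppose that any small S sends
more than κ|S| comparisons out of any superset S' of at most R|S| and at most half of the subjects.
If B ≤ cδκ, lowering the level by δ must then multiply the level set by R or make it a majority
(`pow_le_card_level`). When R^K ≥ n, K steps give a majority, both from above and from below; two
majorities intersect, so the oscillation is at most 2Kδ.

The random input is two Chernoff bounds with union bounds: the gradient has size B of order C⁽⁵⁾√(np
log n), and expansion holds with κ = np/8 and R = np/(16 log n). Thus δ is of order (C⁽⁵⁾/C⁽⁴⁾)√(log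
n/(np)). Since Δ → 0 forces R ≥ √(np) eventually, K is of order log n/log(np). As C⁽⁴⁾ ≤ C⁽³⁾, Kδ is
O(Δ). The failure probabilities are summable, and Borel–Cantelli gives the almost sure statement. -/

noncomputable section

namespace PairwiseComparison

/-! ### Concavity of the link function in the score difference -/

section LinkFunction

variable {A : Set ℝ} {f : ℝ → ℝ → ℝ}

theorem StrictlyLogConcave.strictAnti_score (h : StrictlyLogConcave A f) {x : ℝ} (hx : x ∈ A) :
    StrictAnti (score f x) :=
  strictAnti_of_deriv_neg (h.scoreDeriv_neg x hx)

theorem StrictlyLogConcave.strictConcaveOn_log (h : StrictlyLogConcave A f) {x : ℝ}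
    (hx : x ∈ A) : StrictConcaveOn ℝ Set.univ (fun y => Real.log (f x y)) :=
  StrictAnti.strictConcaveOn_univ_of_deriv (h.differentiable_log x hx).continuous
    (h.strictAnti_score hx)

theorem StrictlyLogConcave.hasDerivAt_log (h : StrictlyLogConcave A f) {x : ℝ} (hx : x ∈ A)
    (y : ℝ) : HasDerivAt (fun y => Real.log (f x y)) (score f x y) y :=
  (h.differentiable_log x hx y).hasDerivAt

/-- A lower bound on the curvature of `log f(x; ·)` on an interval makes the score decrease at
least linearly there. -/
theorem StrictlyLogConcave.score_sub_le (h : StrictlyLogConcave A f) {x : ℝ} (hx : x ∈ A)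
    {c r : ℝ} (hc : ∀ y, |y| ≤ r → c ≤ |scoreDeriv f x y|) {a b : ℝ} (ha : |a| ≤ r) (hb : |b| ≤ r)
    (hab : a ≤ b) : score f x b - score f x a ≤ -c * (b - a) := by
  refine (convex_Icc (-r) r).image_sub_le_mul_sub_of_deriv_le
    (h.differentiable_score x hx).continuous.continuousOn
    (h.differentiable_score x hx).differentiableOn ?_ a (abs_le.1 ha) b (abs_le.1 hb) hab
  intro y hy
  rw [interior_Icc] at hy
  have h1 := hc y (abs_le.2 ⟨hy.1.le, hy.2.le⟩)
  have h2 := h.scoreDeriv_neg x hx y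
  rw [abs_of_neg h2] at h1
  unfold scoreDeriv at h1
  linarith

theorem IsValid.nonempty {ν : Measure ℝ} (h : IsValid ν A f) : A.Nonempty := by
  by_contra hA
  have := h.integral_eq_one 0
  simp [Set.not_nonempty_iff_eq_empty.1 hA] at this

/-- The tangent line bound for the logarithm of `f(x; ·)`, exponentiated. -/
theorem StrictlyLogConcave.le_mul_exp (h : StrictlyLogConcave A f) {x : ℝ} (hx : x ∈ A)
    (y s : ℝ) : f x (y + s) ≤ f x y * Real.exp (s * score f x y) := by
  have key : Real.log (f x (y + s)) ≤ Real.log (f x y) + s * score f x y := by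
    have hc := (h.strictConcaveOn_log hx).concaveOn
    have hd := h.hasDerivAt_log hx y
    rcases lt_trichotomy s 0 with hs | rfl | hs
    · have := hc.le_slope_of_hasDerivAt (Set.mem_univ (y + s)) (Set.mem_univ y) (by linarith) hd
      rw [slope_def_field, le_div_iff₀ (by linarith)] at this
      linarith
    · simp
    · have := hc.slope_le_of_hasDerivAt (Set.mem_univ y) (Set.mem_univ (y + s)) (by linarith) hd
      rw [slope_def_field, div_le_iff₀ (by linarith)] at this
      linarith
  have := Real.exp_le_exp.2 key
  rwa [Real.exp_add, Real.exp_log (h.pos x hx _), Real.exp_log (h.pos x hx _)] at this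

/-- Where the score vanishes, `f(x; ·)` has a strict maximum. -/
theorem StrictlyLogConcave.lt_of_score_eq_zero (h : StrictlyLogConcave A f) {x : ℝ} (hx : x ∈ A)
    {y z : ℝ} (hy : score f x y = 0) (hz : z ≠ y) : f x z < f x y := by
  have h1 : ∀ w, f x w ≤ f x y := fun w => by
    have := h.le_mul_exp hx y (w - y)
    simpa [hy] using this
  refine lt_of_le_of_ne (h1 z) fun heq => ?_
  have hc := (h.strictConcaveOn_log hx).2 (Set.mem_univ z) (Set.mem_univ y) hz
    one_half_pos one_half_pos (by norm_num)
  have h2 := Real.log_le_log (h.pos x hx _) (h1 ((1 / 2 : ℝ) • z + (1 / 2 : ℝ) • y))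
  simp only [heq, smul_eq_mul] at hc h2
  linarith

end LinkFunction

/-! ### Cuts of the comparison graph and directional scores -/

theorem abs_sub_le_dynamicRange {n : ℕ} (u : Fin n → ℝ) (i j : Fin n) :
    |u i - u j| ≤ dynamicRange u :=
  (le_ciSup (f := fun j => |u i - u j|) (Set.finite_range _).bddAbove j).trans
    (le_ciSup (f := fun i => ⨆ j, |u i - u j|) (Set.finite_range _).bddAbove i)

theorem dynamicRange_nonneg {n : ℕ} (u : Fin n → ℝ) : 0 ≤ dynamicRange u :=
  Real.iSup_nonneg fun _ => Real.iSup_nonneg fun _ => abs_nonneg _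

/-- The increment of the indicator function of `U` along a pair. -/
def cutSign {n : ℕ} (U : Finset (Fin n)) (e : Pair n) : ℝ :=
  (if e.1.1 ∈ U then 1 else 0) - (if e.1.2 ∈ U then 1 else 0)

/-- The number of observed comparisons of a pair. -/
def count {n : ℕ} (T : ℕ) (N : Pair n → ℕ) (e : Pair n) : ℕ :=
  (Finset.univ.filter fun t : Fin T => t.val < N e).card

/-- The pair `e` has one end in `S` and the other one in `W`. -/
def Joins {n : ℕ} (S W : Finset (Fin n)) (e : Pair n) : Prop :=
  (e.1.1 ∈ S ∧ e.1.2 ∈ W) ∨ (e.1.2 ∈ S ∧ e.1.1 ∈ W)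

open Classical in
/-- The number of observed comparisons between `S` and `W`. -/
def cutCount {n : ℕ} (T : ℕ) (N : Pair n → ℕ) (S W : Finset (Fin n)) : ℕ :=
  ∑ e : Pair n with Joins S W e, count T N e

/-- The derivative of the log-likelihood at `w` in the direction of the indicator of `U`. -/
def scoreSum (f : ℝ → ℝ → ℝ) {T n : ℕ} (N : Pair n → ℕ) (X : Pair n → Fin T → ℝ)
    (w : Fin n → ℝ) (U : Finset (Fin n)) : ℝ :=
  ∑ e : Pair n, ∑ t : Fin T with t.val < N e,
    cutSign U e * score f (X e t) (w e.1.1 - w e.1.2)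

/-! ### First order conditions for the constrained maximizer -/

section Deterministic

variable {A : Set ℝ} {f : ℝ → ℝ → ℝ} {T n : ℕ} {N : Pair n → ℕ} {X : Pair n → Fin T → ℝ}
  {u v : Fin n → ℝ}

theorem cutSign_compl (U : Finset (Fin n)) (e : Pair n) : cutSign Uᶜ e = -cutSign U e := by
  unfold cutSign
  by_cases h1 : e.1.1 ∈ U <;> by_cases h2 : e.1.2 ∈ U <;> simp [h1, h2]

theorem cutSign_eq_sum (U : Finset (Fin n)) (e : Pair n) :
    cutSign U e = ∑ i ∈ U, cutSign {i} e := by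
  simp [cutSign, Finset.sum_sub_distrib]

theorem scoreSum_compl (w : Fin n → ℝ) (U : Finset (Fin n)) :
    scoreSum f N X w Uᶜ = -scoreSum f N X w U := by
  simp [scoreSum, cutSign_compl]

theorem scoreSum_eq_sum (w : Fin n → ℝ) (U : Finset (Fin n)) :
    scoreSum f N X w U = ∑ i ∈ U, scoreSum f N X w {i} := by
  unfold scoreSum
  rw [Finset.sum_comm]
  refine Finset.sum_congr rfl fun e _ => ?_
  rw [Finset.sum_comm]
  refine Finset.sum_congr rfl fun t _ => ?_
  rw [cutSign_eq_sum, Finset.sum_mul]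

theorem abs_scoreSum_le {w : Fin n → ℝ} {B : ℝ} (hB : ∀ i, |scoreSum f N X w {i}| ≤ B)
    (U : Finset (Fin n)) : |scoreSum f N X w U| ≤ U.card * B := by
  rw [scoreSum_eq_sum]
  refine (Finset.abs_sum_le_sum_abs _ _).trans ?_
  simpa using Finset.sum_le_card_nsmul U _ B fun i _ => hB i

theorem logLikelihood_add_const (w : Fin n → ℝ) (s : ℝ) :
    logLikelihood f N X (fun i => w i + s) = logLikelihood f N X w := by
  simp [logLikelihood]

theorem continuous_logLikelihood (hconc : StrictlyLogConcave A f) (hX : ∀ e t, X e t ∈ A) :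
    Continuous (logLikelihood f N X) := by
  unfold logLikelihood
  refine continuous_finsetSum _ fun e _ => continuous_finsetSum _ fun t _ => ?_
  exact (hconc.differentiable_log _ (hX e t)).continuous.comp (by fun_prop)

theorem concaveOn_logLikelihood (hconc : StrictlyLogConcave A f) (hX : ∀ e t, X e t ∈ A)
    (w w' : Fin n → ℝ) {a b : ℝ} (ha : 0 ≤ a) (hb : 0 ≤ b) (hab : a + b = 1) :
    a * logLikelihood f N X w + b * logLikelihood f N X w' ≤
      logLikelihood f N X (fun i => a * w i + b * w' i) := by
  simp only [logLikelihood, Finset.mul_sum, ← Finset.sum_add_distrib]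
  refine Finset.sum_le_sum fun e _ => Finset.sum_le_sum fun t _ => ?_
  have := (hconc.strictConcaveOn_log (hX e t)).concaveOn.2 (Set.mem_univ (w e.1.1 - w e.1.2))
    (Set.mem_univ (w' e.1.1 - w' e.1.2)) ha hb hab
  simp only [smul_eq_mul] at this
  convert this using 3
  ring

theorem logLikelihood_midpoint_lt (hconc : StrictlyLogConcave A f) (hX : ∀ e t, X e t ∈ A)
    (w w' : Fin n → ℝ) {e : Pair n} (he : count T N e ≠ 0)
    (hne : w e.1.1 - w e.1.2 ≠ w' e.1.1 - w' e.1.2) :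
    1 / 2 * logLikelihood f N X w + 1 / 2 * logLikelihood f N X w' <
      logLikelihood f N X (fun i => 1 / 2 * w i + 1 / 2 * w' i) := by
  simp only [logLikelihood, Finset.mul_sum, ← Finset.sum_add_distrib]
  have key : ∀ e : Pair n, (1 / 2 : ℝ) * w e.1.1 + 1 / 2 * w' e.1.1 -
      (1 / 2 * w e.1.2 + 1 / 2 * w' e.1.2) = (1 / 2 : ℝ) • (w e.1.1 - w e.1.2) + (1 / 2 : ℝ) • (w' e.1.1 - w' e.1.2) := by
    intro e
    simp only [smul_eq_mul]
    ring
  have hle : ∀ (e : Pair n) (t : Fin T),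
      1 / 2 * Real.log (f (X e t) (w e.1.1 - w e.1.2)) +
        1 / 2 * Real.log (f (X e t) (w' e.1.1 - w' e.1.2)) ≤
      Real.log (f (X e t) (1 / 2 * w e.1.1 + 1 / 2 * w' e.1.1 -
        (1 / 2 * w e.1.2 + 1 / 2 * w' e.1.2))) := fun e t => by
    rw [key e]
    exact (hconc.strictConcaveOn_log (hX e t)).concaveOn.2 (Set.mem_univ _)
      (Set.mem_univ _) (by norm_num) (by norm_num) (by norm_num)
  refine Finset.sum_lt_sum (fun e _ => Finset.sum_le_sum fun t _ => hle e t)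
    ⟨e, Finset.mem_univ _, Finset.sum_lt_sum_of_nonempty ?_ fun t _ => ?_⟩
  · exact Finset.card_ne_zero.1 he
  · rw [key e]
    exact (hconc.strictConcaveOn_log (hX e t)).2 (Set.mem_univ _)
      (Set.mem_univ _) hne (by norm_num) (by norm_num) (by norm_num)

/-- The parameters whose error has oscillation at most `1`. -/
def nearSpace {n : ℕ} (u : Fin n → ℝ) : Set (Fin n → ℝ) :=
  {v | ∀ i j, (v i - u i) - (v j - u j) ≤ 1}

/-- `nearSpace u` is not compact, but it and the likelihood are invariant under adding a constant,
and the slice normalized at the first subject is a closed part of the unit ball about `u`.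
Maximality on all of `nearSpace u` is what permits moving any set of coordinates later, including
the first one. -/
theorem exists_isMaxOn_nearSpace (hconc : StrictlyLogConcave A f) (hX : ∀ e t, X e t ∈ A)
    (hn : 0 < n) (hu : u ∈ paramSpace n) :
    ∃ v ∈ paramSpace n, v ∈ nearSpace u ∧ IsMaxOn (logLikelihood f N X) (nearSpace u) v := by
  set i₀ : Fin n := ⟨0, hn⟩
  have hclosed : IsClosed (paramSpace n ∩ nearSpace u) := by
    refine IsClosed.inter ?_ ?_
    · simp only [paramSpace, Set.ofPred_forall]
      exact isClosed_iInter fun i => isClosed_iInter fun _ =>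
        isClosed_eq (continuous_apply i) continuous_const
    · simp only [nearSpace, Set.ofPred_forall]
      exact isClosed_iInter fun i => isClosed_iInter fun j =>
        isClosed_le (by fun_prop) continuous_const
  have hcompact : IsCompact (paramSpace n ∩ nearSpace u) := by
    refine (isCompact_closedBall u 1).of_isClosed_subset hclosed fun v hv => ?_
    rw [Metric.mem_closedBall, dist_pi_le_iff zero_le_one]
    intro i
    have h1 := hv.2 i i₀
    have h2 := hv.2 i₀ i
    have h3 : v i₀ = 0 := hv.1 i₀ rfl
    have h4 : u i₀ = 0 := hu i₀ rfl
    rw [Real.dist_eq, abs_le]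
    constructor <;> linarith
  obtain ⟨v, hv, hmax⟩ := hcompact.exists_isMaxOn ⟨u, hu, fun i j => by simp⟩
    (continuous_logLikelihood (N := N) hconc hX).continuousOn
  refine ⟨v, hv.1, hv.2, fun w hw => ?_⟩
  have := hmax (a := fun i => w i + -(w i₀)) ⟨fun i hi => ?_, fun i j => ?_⟩
  · simpa only [Set.mem_ofPred_eq, logLikelihood_add_const] using this
  · have : i = i₀ := Fin.ext hi
    simp [this]
  · have := hw i j
    linarith

/-- The first order condition at a constrained maximizer `v`, for moving the coordinates in `U`
downwards, where the error `v - u` is larger on `U` than off `U`. -/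
theorem scoreSum_nonneg_of_isMaxOn (hconc : StrictlyLogConcave A f) (hX : ∀ e t, X e t ∈ A)
    (hv : v ∈ nearSpace u) (hmax : IsMaxOn (logLikelihood f N X) (nearSpace u) v)
    (U : Finset (Fin n)) (hU : ∀ i ∈ U, ∀ j ∉ U, v j - u j < v i - u i) :
    0 ≤ scoreSum f N X v U := by
  set γ : ℝ → Fin n → ℝ := fun s i => v i - s * (if i ∈ U then 1 else 0)
  have hderiv : HasDerivAt (fun s => logLikelihood f N X (γ s)) (-scoreSum f N X v U) 0 := by
    unfold logLikelihood scoreSum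
    simp only [← Finset.sum_neg_distrib]
    refine HasDerivAt.fun_sum fun e _ => HasDerivAt.fun_sum fun t _ => ?_
    have h1 : HasDerivAt (fun s => γ s e.1.1 - γ s e.1.2) (-cutSign U e) 0 := by
      have := ((hasDerivAt_id (0 : ℝ)).mul_const (-cutSign U e)).const_add (v e.1.1 - v e.1.2)
      simp only [one_mul, id] at this
      refine this.congr_of_eventuallyEq (Eventually.of_forall fun s => ?_)
      simp only [γ, cutSign]
      ring
    have h2 : HasDerivAt (fun y => Real.log (f (X e t) y))
        (score f (X e t) (v e.1.1 - v e.1.2)) (γ 0 e.1.1 - γ 0 e.1.2) := by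
      simpa [γ] using hconc.hasDerivAt_log (hX e t) (v e.1.1 - v e.1.2)
    refine (h2.comp (0 : ℝ) h1).congr_deriv ?_
    ring
  -- Lowering `U` only shrinks the positive gaps from `U` to its complement. The reversed gaps are
  -- negative at the start, so they stay below 1 for small `s`, even when `v` lies on the boundary
  -- of `nearSpace u`.
  have hev : ∀ᶠ s in 𝓝[>] (0 : ℝ), γ s ∈ nearSpace u := by
    have h1 : ∀ᶠ s in 𝓝[>] (0 : ℝ), ∀ i ∈ U, ∀ j, j ∉ U → s < (v i - u i) - (v j - u j) := by
      refine eventually_all.2 fun i => ?_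
      by_cases hi : i ∈ U
      · simp only [hi, true_imp_iff]
        refine eventually_all.2 fun j => ?_
        by_cases hj : j ∈ U
        · simp [hj]
        · have := hU i hi j hj
          simp only [hj, not_false_iff, true_imp_iff]
          exact mem_nhdsWithin_of_mem_nhds (eventually_lt_nhds (by linarith))
      · simp [hi]
    filter_upwards [h1, self_mem_nhdsWithin] with s hs hs0 i j
    have hs0 : 0 < s := hs0
    have := hv i j
    by_cases hi : i ∈ U <;> by_cases hj : j ∈ U <;> simp only [γ, hi, hj, if_true, if_false]
    · linarith
    · linarith
    · have := hs j hj i hi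
      linarith
    · linarith
  have hslope := (hasDerivAt_iff_tendsto_slope.1 hderiv).mono_left
    (show 𝓝[>] (0 : ℝ) ≤ 𝓝[≠] 0 from nhdsWithin_mono 0 fun s hs => ne_of_gt hs)
  have : -scoreSum f N X v U ≤ 0 := by
    refine le_of_tendsto hslope ?_
    filter_upwards [hev, self_mem_nhdsWithin] with s hs hs0
    have hs0 : 0 < s := hs0
    have h0 : γ 0 = v := by
      funext i
      simp [γ]
    have := hmax hs
    simp only [Set.mem_ofPred_eq] at this
    rw [slope_def_field, h0, sub_zero]
    exact div_nonpos_of_nonpos_of_nonneg (by linarith) hs0.le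
  linarith

theorem cutSign_mul_nonneg {d : Fin n → ℝ} {U : Finset (Fin n)}
    (hU : ∀ i ∈ U, ∀ j ∉ U, d j < d i) (e : Pair n) :
    0 ≤ cutSign U e * (d e.1.1 - d e.1.2) := by
  unfold cutSign
  by_cases hi : e.1.1 ∈ U <;> by_cases hj : e.1.2 ∈ U <;> simp only [hi, hj, if_true, if_false]
  · simp
  · have := hU _ hi _ hj
    linarith
  · have := hU _ hj _ hi
    linarith
  · simp

/-- The curvature turns the first order condition into a bound for the total error increment
across the boundary of an upper level set of the error. -/
theorem sum_cutSign_le_scoreSum (hconc : StrictlyLogConcave A f) (hX : ∀ e t, X e t ∈ A)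
    {c : ℝ} (hc : ∀ x ∈ A, ∀ y, |y| ≤ dynamicRange u + 1 → c ≤ |scoreDeriv f x y|)
    (hv : v ∈ nearSpace u) (hmax : IsMaxOn (logLikelihood f N X) (nearSpace u) v)
    (U : Finset (Fin n)) (hU : ∀ i ∈ U, ∀ j ∉ U, v j - u j < v i - u i) :
    c * ∑ e, count T N e * (cutSign U e * ((v e.1.1 - u e.1.1) - (v e.1.2 - u e.1.2))) ≤
      scoreSum f N X u U := by
  have h0 := scoreSum_nonneg_of_isMaxOn hconc hX hv hmax U hU
  suffices h : scoreSum f N X v U ≤ scoreSum f N X u U - c * ∑ e, count T N e *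
      (cutSign U e * ((v e.1.1 - u e.1.1) - (v e.1.2 - u e.1.2))) by linarith
  unfold scoreSum
  rw [Finset.mul_sum, ← Finset.sum_sub_distrib]
  refine Finset.sum_le_sum fun e _ => ?_
  have : c * (count T N e * (cutSign U e * ((v e.1.1 - u e.1.1) - (v e.1.2 - u e.1.2)))) =
      ∑ t : Fin T with t.val < N e,
        c * (cutSign U e * ((v e.1.1 - u e.1.1) - (v e.1.2 - u e.1.2))) := by
    rw [Finset.sum_const, nsmul_eq_mul, count]
    ring
  rw [this, ← Finset.sum_sub_distrib]
  refine Finset.sum_le_sum fun t _ => ?_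
  have hur := abs_sub_le_dynamicRange u e.1.1 e.1.2
  -- The oscillation bound 1 of `nearSpace u` accounts for the radius M + 1 in the curvature
  -- constants.
  have hvr : |v e.1.1 - v e.1.2| ≤ dynamicRange u + 1 := by
    have h1 := hv e.1.1 e.1.2
    have h2 := hv e.1.2 e.1.1
    rw [abs_le] at hur ⊢
    constructor <;> linarith
  have hur' : |u e.1.1 - u e.1.2| ≤ dynamicRange u + 1 := by linarith
  have hcx := hc _ (hX e t)
  -- Only pairs cut by `U` contribute; for them the orientation decides which of the differences of
  -- `u` and of `v` is the larger argument of the decreasing score.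
  unfold cutSign
  by_cases hi : e.1.1 ∈ U <;> by_cases hj : e.1.2 ∈ U <;> simp only [hi, hj, if_true, if_false]
  · simp
  · have h1 := hU _ hi _ hj
    have h2 := hconc.score_sub_le (hX e t) hcx hur' hvr (by linarith)
    linarith
  · have h1 := hU _ hj _ hi
    have h2 := hconc.score_sub_le (hX e t) hcx hvr hur' (by linarith)
    linarith
  · simp

end Deterministic

/-! ### Growth of level sets on an expanding graph, existence and uniqueness -/

section Growth

variable {A : Set ℝ} {f : ℝ → ℝ → ℝ} {T n : ℕ} {N : Pair n → ℕ} {X : Pair n → Fin T → ℝ}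
  {u v : Fin n → ℝ}

/-- Every small set of subjects is compared often with the complement of any moderately larger
set. -/
def Expands (T : ℕ) (N : Pair n → ℕ) (R κ : ℝ) : Prop :=
  ∀ S S' : Finset (Fin n), S.Nonempty → S ⊆ S' → (S'.card : ℝ) ≤ R * S.card → 2 * S'.card ≤ n →
    κ * S.card < cutCount T N S S'ᶜ

/-- Comparisons from `S` to the complement of `S'` each drop by at least `δ`; the remaining ones cut
by `S` have nonnegative drop and may be discarded. -/
theorem mul_cutCount_le {d : Fin n → ℝ} {S S' : Finset (Fin n)} (hSS' : S ⊆ S') {δ : ℝ}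
    (hS : ∀ i ∈ S, ∀ j ∉ S, d j < d i) (hδ : ∀ i ∈ S, ∀ j ∉ S', d j + δ ≤ d i) :
    δ * cutCount T N S S'ᶜ ≤ ∑ e, count T N e * (cutSign S e * (d e.1.1 - d e.1.2)) := by
  classical
  unfold cutCount
  push_cast
  rw [Finset.mul_sum]
  refine (Finset.sum_le_sum fun e he => ?_).trans (Finset.sum_le_sum_of_subset_of_nonneg
    (Finset.subset_univ _) fun e _ _ => mul_nonneg (Nat.cast_nonneg _) (cutSign_mul_nonneg hS e))
  rw [mul_comm]
  refine mul_le_mul_of_nonneg_left ?_ (Nat.cast_nonneg _)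
  simp only [Finset.mem_filter, Finset.mem_univ, true_and, Joins, Finset.mem_compl] at he
  unfold cutSign
  rcases he with ⟨hi, hj⟩ | ⟨hi, hj⟩
  · have h := hδ _ hi _ hj
    have hj' : e.1.2 ∉ S := fun h => hj (hSS' h)
    simp only [hi, hj', if_true, if_false]
    linarith
  · have h := hδ _ hi _ hj
    have hj' : e.1.1 ∉ S := fun h => hj (hSS' h)
    simp only [hi, hj', if_true, if_false]
    linarith

/-- The upper level sets of `d` grow geometrically until they contain half of the subjects. -/
theorem pow_le_card_level {R κ B c δ : ℝ} (hexp : Expands T N R κ) (hR : 0 ≤ R) (hc : 0 < c)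
    (hδ : 0 < δ) (hB : B ≤ c * δ * κ) {d : Fin n → ℝ}
    (hcut : ∀ U : Finset (Fin n), (∀ i ∈ U, ∀ j ∉ U, d j < d i) →
      c * ∑ e, count T N e * (cutSign U e * (d e.1.1 - d e.1.2)) ≤ U.card * B)
    (i₀ : Fin n) (k : ℕ) :
    R ^ k ≤ ((Finset.univ.filter fun i => d i₀ - k * δ ≤ d i).card : ℝ) ∨
      n < 2 * (Finset.univ.filter fun i => d i₀ - k * δ ≤ d i).card := by
  set S : ℕ → Finset (Fin n) := fun k => Finset.univ.filter fun i => d i₀ - k * δ ≤ d i with hS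
  have hmem : ∀ k i, i ∈ S k ↔ d i₀ - k * δ ≤ d i := fun k i => by simp [S]
  change R ^ k ≤ ((S k).card : ℝ) ∨ n < 2 * (S k).card
  have hne : ∀ k, (S k).Nonempty := fun k => ⟨i₀, by
    rw [hmem]
    have : 0 ≤ k * δ := by positivity
    linarith⟩
  induction k with
  | zero =>
    left
    have := (hne 0).card_pos
    rw [pow_zero]
    exact_mod_cast this
  | succ k ih =>
    have hsub : S k ⊆ S (k + 1) := fun i hi => by
      rw [hmem] at hi ⊢
      push_cast
      linarith
    rcases ih with ih | ih
    -- Otherwise expansion applies to two consecutive level sets: more than κ|S_k| comparisons drop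
    -- by at least δ, so |S_k|B exceeds cδκ|S_k|, against `hB`.
    · by_contra! hcon
      obtain ⟨h1, h2⟩ := hcon
      have hle : ((S (k + 1)).card : ℝ) ≤ R * (S k).card := by
        rw [pow_succ, mul_comm] at h1
        exact h1.le.trans (mul_le_mul_of_nonneg_left ih hR)
      have h3 := hexp _ _ (hne k) hsub hle h2
      have hup : ∀ i ∈ S k, ∀ j ∉ S k, d j < d i := fun i hi j hj => by
        rw [hmem] at hi hj
        linarith
      have h4 := hcut _ hup
      have h5 := mul_cutCount_le (T := T) (N := N) hsub (δ := δ) hup fun i hi j hj => by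
        rw [hmem] at hi hj
        push_cast at hj
        linarith
      have hpos : 0 < ((S k).card : ℝ) := by exact_mod_cast (hne k).card_pos
      have h6 := mul_le_mul_of_nonneg_left h5 hc.le
      have h7 := mul_lt_mul_of_pos_left h3 (mul_pos hc hδ)
      have h8 := mul_le_mul_of_nonneg_left hB hpos.le
      linarith
    · exact Or.inr (ih.trans_le (Nat.mul_le_mul_left 2 (Finset.card_le_card hsub)))

/-- On a graph that expands, the error of the constrained maximizer has small oscillation. -/
theorem sub_le_of_expands (hconc : StrictlyLogConcave A f) (hX : ∀ e t, X e t ∈ A)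
    {c R κ B δ : ℝ} (hc : ∀ x ∈ A, ∀ y, |y| ≤ dynamicRange u + 1 → c ≤ |scoreDeriv f x y|)
    (hexp : Expands T N R κ) (hR : 0 ≤ R) (hc0 : 0 < c)
    (hδ : 0 < δ) (hB : B ≤ c * δ * κ)
    (hnoise : ∀ i, |scoreSum f N X u {i}| ≤ B) {K : ℕ} (hK : n ≤ R ^ K) (hv : v ∈ nearSpace u)
    (hmax : IsMaxOn (logLikelihood f N X) (nearSpace u) v) (i j : Fin n) :
    (v i - u i) - (v j - u j) ≤ 2 * (K * δ) := by
  set d : Fin n → ℝ := fun i => v i - u i with hd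
  have h1 := pow_le_card_level hexp hR hc0 hδ hB (d := d) (fun U hU =>
    (sum_cutSign_le_scoreSum hconc hX hc hv hmax U hU).trans
      ((le_abs_self _).trans (abs_scoreSum_le hnoise U))) i K
  have h2 := pow_le_card_level hexp hR hc0 hδ hB (d := fun i => -d i) (fun U hU => by
    -- A lower level set `U` of `d` is handled through the upper level set `Uᶜ`. Since the two
    -- directional scores are opposite, the noise is still charged to |U| and not to the possibly
    -- much larger |Uᶜ|.
    have hU' : ∀ i ∈ Uᶜ, ∀ j ∉ Uᶜ, d j < d i := fun i hi j hj => by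
      simp only [Finset.mem_compl, not_not] at hi hj
      linarith [hU j hj i hi]
    have h3 := sum_cutSign_le_scoreSum hconc hX hc hv hmax Uᶜ hU'
    rw [scoreSum_compl] at h3
    have h4 := h3.trans ((neg_le_abs _).trans (abs_scoreSum_le hnoise U))
    refine le_of_eq_of_le ?_ h4
    congr 1
    refine Finset.sum_congr rfl fun e _ => ?_
    rw [cutSign_compl]
    ring) j K
  have hcard : ∀ S : Finset (Fin n), R ^ K ≤ (S.card : ℝ) ∨ n < 2 * S.card → n < 2 * S.card := by
    rintro S (h | h)
    · have h' : (n : ℝ) ≤ S.card := hK.trans h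
      have : n ≤ S.card := by exact_mod_cast h'
      have := i.pos
      omega
    · exact h
  obtain ⟨k, hk⟩ : ∃ k, k ∈ (Finset.univ.filter fun i' => d i - K * δ ≤ d i') ∩
      (Finset.univ.filter fun i' => -d j - K * δ ≤ -d i') := by
    by_contra! hcon
    have hdisj := Finset.card_union_of_disjoint
      (Finset.disjoint_iff_inter_eq_empty.2 (Finset.eq_empty_of_forall_notMem hcon))
    have h5 := hcard _ h1
    have h6 := hcard _ h2
    have h7 := Finset.card_le_univ ((Finset.univ.filter fun i' => d i - K * δ ≤ d i') ∪
      (Finset.univ.filter fun i' => -d j - K * δ ≤ -d i'))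
    rw [Fintype.card_fin] at h7
    omega
  simp only [Finset.mem_inter, Finset.mem_filter, Finset.mem_univ, true_and] at hk
  linarith [hk.1, hk.2]

/-- The comparison graph of an expanding data set is connected. -/
theorem Expands.eq_of_forall_count {R κ : ℝ} (hexp : Expands T N R κ) (hR : 1 ≤ R) (hκ : 0 ≤ κ)
    {D : Fin n → ℝ} (hD : ∀ e : Pair n, count T N e ≠ 0 → D e.1.1 = D e.1.2) (i j : Fin n) :
    D i = D j := by
  classical
  have key : ∀ S : Finset (Fin n), S.Nonempty → 2 * S.card ≤ n →
      ∃ a ∈ S, ∃ b ∉ S, D a = D b := by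
    intro S hS hSn
    -- Expansion with S' = S, admissible because R ≥ 1, says that some comparison leaves `S`.
    have h1 := hexp S S hS subset_rfl (by nlinarith [Nat.cast_nonneg (α := ℝ) S.card]) hSn
    have h2 : (0 : ℝ) < cutCount T N S Sᶜ := lt_of_le_of_lt (by positivity) h1
    have h3 : cutCount T N S Sᶜ ≠ 0 := by
      have : 0 < cutCount T N S Sᶜ := by exact_mod_cast h2
      omega
    obtain ⟨e, he, hce⟩ := Finset.exists_ne_zero_of_sum_ne_zero h3
    simp only [Finset.mem_filter, Finset.mem_univ, true_and, Joins, Finset.mem_compl] at he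
    rcases he with ⟨h4, h5⟩ | ⟨h4, h5⟩
    · exact ⟨_, h4, _, h5, hD e hce⟩
    · exact ⟨_, h4, _, h5, (hD e hce).symm⟩
  by_contra hij
  set S : Finset (Fin n) := Finset.univ.filter fun k => D k = D i with hS
  have hsplit : S.card + Sᶜ.card = n := by
    rw [Finset.card_add_card_compl, Fintype.card_fin]
  by_cases hcase : 2 * S.card ≤ n
  · obtain ⟨a, ha, b, hb, hab⟩ := key S ⟨i, by simp [S]⟩ hcase
    simp only [S, Finset.mem_filter, Finset.mem_univ, true_and] at ha hb
    exact hb (hab ▸ ha)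
  · obtain ⟨a, ha, b, hb, hab⟩ := key Sᶜ ⟨j, by simp [S, Ne.symm hij]⟩ (by omega)
    simp only [S, Finset.mem_compl, Finset.mem_filter, Finset.mem_univ, true_and, not_not] at ha hb
    exact ha (hab.trans hb)

/-- A constrained maximizer in the interior of `nearSpace u` is the unique maximum likelihood
estimator. -/
theorem isUniqueMLE_of_isMaxOn_nearSpace (hconc : StrictlyLogConcave A f)
    (hX : ∀ e t, X e t ∈ A) {R κ : ℝ} (hexp : Expands T N R κ) (hR : 1 ≤ R) (hκ : 0 ≤ κ)
    (hn : 0 < n) (hvp : v ∈ paramSpace n)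
    (hmax : IsMaxOn (logLikelihood f N X) (nearSpace u) v) {ε : ℝ} (hε : ε < 1)
    (hosc : ∀ i j, (v i - u i) - (v j - u j) ≤ ε) : IsUniqueMLE f N X v := by
  have hglobal : ∀ w, logLikelihood f N X w ≤ logLikelihood f N X v := by
    intro w
    -- The slack ε < 1 lets a short step from `v` towards an arbitrary `w` remain in `nearSpace u`;
    -- concavity on the segment then compares the endpoints.
    have hev : ∀ᶠ s in 𝓝[>] (0 : ℝ), (fun i => (1 - s) * v i + s * w i) ∈ nearSpace u := by
      have : ∀ i j, ∀ᶠ s in 𝓝[>] (0 : ℝ),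
          ((1 - s) * v i + s * w i - u i) - ((1 - s) * v j + s * w j - u j) < 1 := by
        intro i j
        have hcont : ContinuousAt (fun s : ℝ =>
          ((1 - s) * v i + s * w i - u i) - ((1 - s) * v j + s * w j - u j)) 0 := by fun_prop
        refine mem_nhdsWithin_of_mem_nhds (hcont.eventually_lt continuousAt_const ?_)
        simpa using (hosc i j).trans_lt hε
      filter_upwards [eventually_all.2 fun i => eventually_all.2 (this i)] with s hs i j
      exact (hs i j).le
    have hlt : ∀ᶠ s in 𝓝[>] (0 : ℝ), s < 1 :=
      mem_nhdsWithin_of_mem_nhds (eventually_lt_nhds one_pos)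
    obtain ⟨s, hs, hs1, hs0⟩ := (hev.and (hlt.and self_mem_nhdsWithin)).exists
    have hs0 : 0 < s := hs0
    have h1 := concaveOn_logLikelihood (N := N) hconc hX v w (a := 1 - s) (b := s) (by linarith)
      hs0.le (by ring)
    have h2 := hmax hs
    simp only [Set.mem_ofPred_eq] at h2
    nlinarith
  refine ⟨⟨hvp, fun w _ => hglobal w⟩, fun w hw => ?_⟩
  have hwv : logLikelihood f N X w = logLikelihood f N X v :=
    le_antisymm (hglobal w) (hw.2 hvp)
  have hD := hexp.eq_of_forall_count hR hκ (D := fun i => w i - v i) fun e he => by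
    by_contra hne
    have h1 := logLikelihood_midpoint_lt hconc hX w v he fun h => hne (by linarith)
    have h2 := hglobal fun i => 1 / 2 * w i + 1 / 2 * v i
    rw [hwv] at h1
    linarith
  funext i
  have h1 := hD i ⟨0, hn⟩
  have h2 := hvp ⟨0, hn⟩ rfl
  have h3 := hw.1 ⟨0, hn⟩ rfl
  simp only [h2, h3] at h1
  linarith

/-- The deterministic part of the consistency theorem. -/
theorem exists_isUniqueMLE (hconc : StrictlyLogConcave A f) (hX : ∀ e t, X e t ∈ A)
    (hn : 0 < n) (hu : u ∈ paramSpace n)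
    {c R κ B δ : ℝ} (hc : ∀ x ∈ A, ∀ y, |y| ≤ dynamicRange u + 1 → c ≤ |scoreDeriv f x y|)
    (hexp : Expands T N R κ) (hR : 1 ≤ R) (hc0 : 0 < c)
    (hδ : 0 < δ) (hκ : 0 < κ) (hB : B ≤ c * δ * κ)
    (hnoise : ∀ i, |scoreSum f N X u {i}| ≤ B) {K : ℕ}
    (hK : n ≤ R ^ K) (hsmall : 2 * (K * δ) < 1) :
    ∃ v, IsUniqueMLE f N X v ∧ ‖v - u‖ ≤ 2 * (K * δ) := by
  obtain ⟨v, hvp, hv, hmax⟩ := exists_isMaxOn_nearSpace (N := N) hconc hX hn hu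
  have hosc := sub_le_of_expands hconc hX hc hexp (zero_le_one.trans hR) hc0 hδ hB hnoise hK
    hv hmax
  refine ⟨v, isUniqueMLE_of_isMaxOn_nearSpace hconc hX hexp hR hκ.le hn hvp hmax hsmall hosc, ?_⟩
  refine (pi_norm_le_iff_of_nonneg (by positivity)).2 fun i => ?_
  have h1 := hosc i ⟨0, hn⟩
  have h2 := hosc ⟨0, hn⟩ i
  have h3 : v ⟨0, hn⟩ = 0 := hvp _ rfl
  have h4 : u ⟨0, hn⟩ = 0 := hu _ rfl
  rw [h3, h4] at h1 h2
  rw [Pi.sub_apply, Real.norm_eq_abs, abs_le]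
  constructor <;> linarith

end Growth

/-! ### Sub-Gaussian norms and exponential moments -/

section SubGaussian

variable {Q : Measure ℝ} {h : ℝ → ℝ} {t : ℝ}

theorem lintegral_exp_le_of_psi2Norm_lt (ht : 0 < t) (hQ : psi2Norm Q h < ENNReal.ofReal t) :
    ∫⁻ x, ENNReal.ofReal (Real.exp (h x ^ 2 / t ^ 2)) ∂Q ≤ 2 := by
  simp only [psi2Norm, iInf_lt_iff] at hQ
  obtain ⟨r, hr, hle, hrt⟩ := hQ
  refine (lintegral_mono fun x => ?_).trans hle
  have : r ≤ t := ((ENNReal.ofReal_lt_ofReal_iff ht).1 hrt).le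
  exact ENNReal.ofReal_le_ofReal (Real.exp_le_exp.2 (by gcongr))

/-- From z ≤ exp z at z = h²/t², the second moment is at most 2t² for every t > 0. -/
theorem ae_eq_zero_of_psi2Norm_eq_zero (hh : AEMeasurable h Q) (hQ : psi2Norm Q h = 0) :
    ∀ᵐ x ∂Q, h x = 0 := by
  have key : ∫⁻ x, ENNReal.ofReal (h x ^ 2) ∂Q = 0 := by
    have hle : ∀ t : ℝ, 0 < t → ∫⁻ x, ENNReal.ofReal (h x ^ 2) ∂Q ≤ ENNReal.ofReal (t ^ 2) * 2 := by
      intro t ht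
      have h1 := lintegral_exp_le_of_psi2Norm_lt (Q := Q) (h := h) ht (by simpa [hQ] using ht)
      refine le_trans ?_ (mul_le_mul_right h1 _)
      rw [← lintegral_const_mul'' _ (by fun_prop)]
      refine lintegral_mono fun x => ?_
      rw [← ENNReal.ofReal_mul (by positivity)]
      refine ENNReal.ofReal_le_ofReal ?_
      have h2 := Real.add_one_le_exp (h x ^ 2 / t ^ 2)
      calc h x ^ 2 = t ^ 2 * (h x ^ 2 / t ^ 2) := by field_simp
        _ ≤ _ := by gcongr; linarith
    have hlim : Tendsto (fun t : ℝ => ENNReal.ofReal (t ^ 2) * 2) (𝓝[>] 0) (𝓝 0) := by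
      have h1 : Tendsto (fun t : ℝ => ENNReal.ofReal (t ^ 2)) (𝓝[>] 0) (𝓝 0) := by
        have : Tendsto (fun t : ℝ => ENNReal.ofReal (t ^ 2)) (𝓝 0)
            (𝓝 (ENNReal.ofReal ((0 : ℝ) ^ 2))) :=
          (ENNReal.continuous_ofReal.comp (continuous_pow 2)).tendsto 0
        simpa using this.mono_left nhdsWithin_le_nhds
      simpa using ENNReal.Tendsto.mul_const h1 (b := 2) (Or.inr (by simp))
    refine le_antisymm (ge_of_tendsto hlim ?_) zero_le
    filter_upwards [self_mem_nhdsWithin] with t ht using hle t ht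
  rw [lintegral_eq_zero_iff' (by fun_prop)] at key
  filter_upwards [key] with x hx
  have : h x ^ 2 ≤ 0 := by simpa using hx
  exact pow_eq_zero_iff (two_ne_zero) |>.1 (le_antisymm this (sq_nonneg _))

theorem integrable_exp_sq_div (hh : AEMeasurable h Q)
    (hQ : ∫⁻ x, ENNReal.ofReal (Real.exp (h x ^ 2 / t ^ 2)) ∂Q ≤ 2) :
    Integrable (fun x => Real.exp (h x ^ 2 / t ^ 2)) Q := by
  refine ⟨(by fun_prop : AEMeasurable _ Q).aestronglyMeasurable, ?_⟩
  rw [hasFiniteIntegral_iff_ofReal (Eventually.of_forall fun x => (Real.exp_pos _).le)]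
  exact hQ.trans_lt (by simp)

theorem integrable_exp_mul (hh : AEMeasurable h Q) (ht : 0 < t)
    (hQ : ∫⁻ x, ENNReal.ofReal (Real.exp (h x ^ 2 / t ^ 2)) ∂Q ≤ 2) (s : ℝ) :
    Integrable (fun x => Real.exp (s * h x)) Q := by
  refine ((integrable_exp_sq_div hh hQ).const_mul (Real.exp (s ^ 2 * t ^ 2))).mono'
    (by fun_prop : AEMeasurable _ Q).aestronglyMeasurable (Eventually.of_forall fun x => ?_)
  rw [Real.norm_of_nonneg (Real.exp_pos _).le, ← Real.exp_add, Real.exp_le_exp]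
  have h1 : s * h x = (s * t) * (h x / t) := by field_simp
  rw [h1, ← mul_pow, ← div_pow]
  nlinarith [sq_nonneg (s * t - h x / t), sq_nonneg (s * t), sq_nonneg (h x / t)]

/-- The linear term integrates to zero for a centred variable, leaving only the moment that the
ψ₂-norm controls. -/
theorem exp_le_add_exp_sq (x : ℝ) : Real.exp x ≤ x + Real.exp (x ^ 2) := by
  have h1 := Real.add_one_le_exp (x ^ 2)
  rcases le_or_gt |x| 1 with hx | hx
  · have := (abs_le.1 (Real.abs_exp_sub_one_sub_id_le hx)).2
    linarith
  · rcases lt_abs.1 hx with hx | hx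
    · have : Real.exp x ≤ Real.exp (x ^ 2) := Real.exp_le_exp.2 (by nlinarith)
      linarith
    · have : Real.exp x ≤ 1 := Real.exp_le_one_iff.2 (by linarith)
      nlinarith

/-- A centred sub-Gaussian variable has a sub-Gaussian moment generating function near `0`. -/
theorem lintegral_exp_mul_le [IsProbabilityMeasure Q] (hh : AEMeasurable h Q) (ht : 0 < t)
    (hQ : ∫⁻ x, ENNReal.ofReal (Real.exp (h x ^ 2 / t ^ 2)) ∂Q ≤ 2) (hint : Integrable h Q)
    (hmean : ∫ x, h x ∂Q = 0) {s : ℝ} (hs : s ^ 2 * t ^ 2 ≤ 1) :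
    ∫⁻ x, ENNReal.ofReal (Real.exp (s * h x)) ∂Q ≤ ENNReal.ofReal (1 + s ^ 2 * t ^ 2) := by
  rw [← ofReal_integral_eq_lintegral_ofReal (integrable_exp_mul hh ht hQ s)
    (Eventually.of_forall fun x => (Real.exp_pos _).le)]
  refine ENNReal.ofReal_le_ofReal ?_
  have hI := integrable_exp_sq_div hh hQ
  have h2 : ∫ x, Real.exp (h x ^ 2 / t ^ 2) ∂Q ≤ 2 := by
    rw [integral_eq_lintegral_of_nonneg_ae (Eventually.of_forall fun x => (Real.exp_pos _).le)
      hI.aestronglyMeasurable]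
    exact ENNReal.toReal_le_of_le_ofReal zero_le_two (by simpa using hQ)
  set θ := s ^ 2 * t ^ 2
  have hθ : 0 ≤ θ := by positivity
  calc ∫ x, Real.exp (s * h x) ∂Q
      ≤ ∫ x, (s * h x + ((1 - θ) + θ * Real.exp (h x ^ 2 / t ^ 2))) ∂Q := by
        refine integral_mono (integrable_exp_mul hh ht hQ s)
          ((hint.const_mul s).add ((integrable_const _).add (hI.const_mul θ))) fun x => ?_
        refine (exp_le_add_exp_sq _).trans ?_
        gcongr
        -- Here (s h)² = θ (h²/t²) with θ ∈ [0, 1], so convexity bounds its exponential by 1 - θ + θ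
        -- exp(h²/t²).
        have h3 := convexOn_exp.2 (Set.mem_univ 0) (Set.mem_univ (h x ^ 2 / t ^ 2))
          (sub_nonneg.2 hs) hθ (by ring)
        simp only [smul_eq_mul, mul_zero, zero_add, Real.exp_zero, mul_one] at h3
        refine le_of_eq_of_le ?_ h3
        congr 1
        simp only [θ]
        field_simp
    _ = (1 - θ) + θ * ∫ x, Real.exp (h x ^ 2 / t ^ 2) ∂Q := by
        have h4 : Integrable (fun x => 1 - θ + θ * Real.exp (h x ^ 2 / t ^ 2)) Q :=
          (integrable_const _).add (hI.const_mul θ)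
        rw [integral_add (hint.const_mul s) h4, integral_add (integrable_const _) (hI.const_mul θ),
          integral_const_mul, integral_const_mul, hmean]
        simp
    _ ≤ 1 + θ := by nlinarith

end SubGaussian

/-! ### The score under the law of an outcome -/

section OutcomeLaw

variable {ν : Measure ℝ} {A : Set ℝ} {f : ℝ → ℝ → ℝ}

theorem IsValid.integrable (hf : IsValid ν A f) (y : ℝ) :
    Integrable (fun x => f x y) (ν.restrict A) := by
  by_contra h
  have := hf.integral_eq_one y
  rw [integral_undef h] at this
  exact zero_ne_one this

theorem IsValid.isProbabilityMeasure_outcomeLaw (hf : IsValid ν A f) (y : ℝ) :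
    IsProbabilityMeasure (outcomeLaw ν A f y) := by
  refine ⟨?_⟩
  have h0 : 0 ≤ᵐ[ν.restrict A] fun x => f x y := by
    filter_upwards [ae_restrict_mem hf.measurableSet] with x hx using hf.nonneg x hx y
  rw [outcomeLaw, withDensity_apply _ MeasurableSet.univ, Measure.restrict_univ,
    ← ofReal_integral_eq_lintegral_ofReal (hf.integrable y) h0, hf.integral_eq_one y]
  simp

theorem outcomeLaw_absolutelyContinuous (y : ℝ) : outcomeLaw ν A f y ≪ ν.restrict A :=
  withDensity_absolutelyContinuous _ _

theorem IsValid.ae_mem (hf : IsValid ν A f) (y : ℝ) : ∀ᵐ x ∂outcomeLaw ν A f y, x ∈ A :=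
  (outcomeLaw_absolutelyContinuous y).ae_le (ae_restrict_mem hf.measurableSet)

/-- Measurability of f(·; z) comes from its integrability, and the score is a pointwise limit on `A`
of difference quotients of log f along a sequence. -/
theorem aemeasurable_score (hf : IsValid ν A f) (hconc : StrictlyLogConcave A f) (y : ℝ) :
    AEMeasurable (fun x => score f x y) (outcomeLaw ν A f y) := by
  refine AEMeasurable.mono_ac ?_ (outcomeLaw_absolutelyContinuous y)
  have hm : ∀ z, AEMeasurable (fun x => f x z) (ν.restrict A) := fun z =>
    (hf.integrable z).aemeasurable
  have hlim : Tendsto (fun k : ℕ => 1 / ((k : ℝ) + 1)) atTop (𝓝[≠] 0) :=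
    tendsto_nhdsWithin_iff.2 ⟨tendsto_one_div_add_atTop_nhds_zero_nat,
      Eventually.of_forall fun k => ne_of_gt (by positivity)⟩
  refine aemeasurable_of_tendsto_metrizable_ae atTop (f := fun (k : ℕ) x =>
    (1 / ((k : ℝ) + 1))⁻¹ • (Real.log (f x (y + 1 / ((k : ℝ) + 1))) - Real.log (f x y)))
    (fun k => (show AEMeasurable _ _ from (hm _).log.sub (hm _).log).const_smul
      (1 / ((k : ℝ) + 1))⁻¹) ?_
  filter_upwards [ae_restrict_mem hf.measurableSet] with x hx
  exact (hasDerivAt_iff_tendsto_slope_zero.1 (hconc.hasDerivAt_log hx y)).comp hlim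

theorem integral_outcomeLaw (hf : IsValid ν A f) (y : ℝ) (φ : ℝ → ℝ) :
    ∫ x, φ x ∂outcomeLaw ν A f y = ∫ x in A, f x y * φ x ∂ν := by
  rw [outcomeLaw, integral_withDensity_eq_integral_toReal_smul₀
    (hf.integrable y).aemeasurable.ennreal_ofReal (by simp)]
  refine setIntegral_congr_fun hf.measurableSet fun x hx => ?_
  simp [ENNReal.toReal_ofReal (hf.nonneg x hx y)]

theorem integrable_outcomeLaw_iff (hf : IsValid ν A f) (y : ℝ) (φ : ℝ → ℝ) :
    Integrable φ (outcomeLaw ν A f y) ↔ Integrable (fun x => f x y * φ x) (ν.restrict A) := by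
  rw [outcomeLaw, integrable_withDensity_iff_integrable_smul₀'
    (hf.integrable y).aemeasurable.ennreal_ofReal (by simp)]
  refine integrable_congr ?_
  filter_upwards [ae_restrict_mem hf.measurableSet] with x hx
  simp [ENNReal.toReal_ofReal (hf.nonneg x hx y)]

/-- The score is centred. -/
theorem integral_score_eq_zero (hf : IsValid ν A f) (hconc : StrictlyLogConcave A f) {y t : ℝ}
    (ht : 0 < t)
    (hQ : ∫⁻ x, ENNReal.ofReal (Real.exp (score f x y ^ 2 / t ^ 2)) ∂outcomeLaw ν A f y ≤ 2) :
    Integrable (fun x => score f x y) (outcomeLaw ν A f y) ∧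
      ∫ x, score f x y ∂outcomeLaw ν A f y = 0 := by
  have := hf.isProbabilityMeasure_outcomeLaw y
  have hexp := integrable_exp_mul (aemeasurable_score hf hconc y) ht hQ
  have huniv : integrableExpSet (fun x => score f x y) (outcomeLaw ν A f y) = Set.univ :=
    Set.eq_univ_of_forall hexp
  have hmem : (0 : ℝ) ∈ interior
      (integrableExpSet (fun x => score f x y) (outcomeLaw ν A f y)) := by simp [huniv]
  refine ⟨by simpa using integrable_pow_of_mem_interior_integrableExpSet hmem 1, ?_⟩
  have hderiv := hasDerivAt_mgf hmem
  -- This replaces differentiation under the integral of f: the tangent bound f(x; y+s) ≤ f(x; y)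
  -- exp(s g(x; y)) integrates to 1 ≤ mgf(s). The mean is the derivative of the mgf at its minimum
  -- 0.
  have hmin : IsLocalMin (mgf (fun x => score f x y) (outcomeLaw ν A f y)) 0 := by
    refine Eventually.of_forall fun s => ?_
    rw [mgf_zero, mgf, integral_outcomeLaw hf, ← hf.integral_eq_one (y + s)]
    refine setIntegral_mono_on (hf.integrable _)
      ((integrable_outcomeLaw_iff hf y _).1 (hexp s)) hf.measurableSet fun x hx => ?_
    exact hconc.le_mul_exp hx y s
  simpa using hmin.hasDerivAt_eq_zero hderiv

/-- The score is not degenerate. -/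
theorem psi2Norm_score_ne_zero (hf : IsValid ν A f) (hconc : StrictlyLogConcave A f) (y : ℝ) :
    psi2Norm (outcomeLaw ν A f y) (fun x => score f x y) ≠ 0 := by
  intro h0
  have h1 := ae_eq_zero_of_psi2Norm_eq_zero (aemeasurable_score hf hconc y) h0
  have h2 : ∀ᵐ x ∂ν.restrict A, score f x y = 0 := by
    rw [outcomeLaw, ae_withDensity_iff' (hf.integrable y).aemeasurable.ennreal_ofReal] at h1
    filter_upwards [h1, ae_restrict_mem hf.measurableSet] with x hx hxA
    exact hx (by simpa using hconc.pos x hxA y)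
  -- A vanishing score makes `y` a strict maximum for almost every outcome, which is impossible as
  -- both densities integrate to 1.
  have h3 : ∀ᵐ x ∂ν.restrict A, 0 < f x y - f x (y + 1) := by
    filter_upwards [h2, ae_restrict_mem hf.measurableSet] with x hx hxA
    linarith [hconc.lt_of_score_eq_zero hxA hx (z := y + 1) (by simp)]
  have h4 : ∫ x in A, (f x y - f x (y + 1)) ∂ν = 0 := by
    rw [integral_sub (hf.integrable _) (hf.integrable _), hf.integral_eq_one, hf.integral_eq_one,
      sub_self]
  rw [integral_eq_zero_iff_of_nonneg_ae (h3.mono fun x hx => hx.le)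
    ((hf.integrable _).sub (hf.integrable _))] at h4
  have h5 : ∀ᵐ x ∂ν.restrict A, False := by
    filter_upwards [h3, h4] with x hx hx'
    exact hx.ne' hx'
  have h6 := hf.integral_eq_one 0
  rw [ae_iff] at h5
  simp only [not_false_eq_true, Set.ofPred_true, Measure.measure_univ_eq_zero] at h5
  simp [h5] at h6

end OutcomeLaw

/-! ### Exponential moments with random numbers of comparisons -/

section Independence

variable {Ω : Type*} [MeasurableSpace Ω] {P : Measure Ω}
  {ν : Measure ℝ} {A : Set ℝ} {f : ℝ → ℝ → ℝ} {T n : ℕ} {p : ℝ} {u : Fin n → ℝ}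
  {N : Pair n → Ω → ℕ} {X : Pair n → Fin T → Ω → ℝ}

theorem IsComparisonData.ae_count_le (hdata : IsComparisonData P ν A f T p u N X) :
    ∀ᵐ ω ∂P, ∀ e, N e ω ≤ T := by
  refine ae_all_iff.2 fun e => ?_
  have : ∀ k : ℕ, ∀ᵐ ω ∂P, T < k → N e ω ≠ k := by
    intro k
    by_cases hk : T < k
    · have h := hdata.count_law e k
      rw [Nat.choose_eq_zero_of_lt hk] at h
      simp only [Nat.cast_zero, zero_mul, ENNReal.ofReal_zero] at h
      rw [ae_iff]
      simpa [hk] using h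
    · simp [hk]
  filter_upwards [ae_all_iff.2 this] with ω hω
  by_contra hlt
  exact hω _ (not_le.1 hlt) rfl

theorem card_filter_val_lt {k : ℕ} (hk : k ≤ T) :
    (Finset.univ.filter fun t : Fin T => t.val < k).card = k := by
  rw [Fin.card_filter_val_lt, min_eq_right hk]

theorem sum_binomial_mul_pow {m : ℝ} (hp : p ∈ Set.Icc (0 : ℝ) 1) (hm : 0 ≤ m) :
    ∑ k : Fin (T + 1), ENNReal.ofReal ((T.choose k : ℝ) * p ^ (k : ℕ) * (1 - p) ^ (T - k)) *
      ENNReal.ofReal m ^ (k : ℕ) = ENNReal.ofReal ((1 - p + p * m) ^ T) := by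
  have h1 : 0 ≤ 1 - p := sub_nonneg.2 hp.2
  have h0 : 0 ≤ p := hp.1
  rw [add_comm (1 - p), add_pow, Finset.sum_range, ENNReal.ofReal_sum_of_nonneg]
  · refine Finset.sum_congr rfl fun k _ => ?_
    rw [← ENNReal.ofReal_pow hm, ← ENNReal.ofReal_mul (by positivity)]
    congr 1
    rw [mul_pow]
    ring
  · intro k _
    positivity

/-- An exponential moment bound for the observed outcomes, obtained by conditioning on the numbers
of comparisons. -/
theorem IsComparisonData.lintegral_prod_le [IsProbabilityMeasure P]
    (hdata : IsComparisonData P ν A f T p u N X)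
    (hp : p ∈ Set.Icc (0 : ℝ) 1) {h : Pair n → Fin T → ℝ → ℝ≥0∞} (hh : ∀ e t, Measurable (h e t))
    {m : Pair n → ℝ} (hm : ∀ e, 0 ≤ m e)
    (hle : ∀ e t, ∫⁻ x, h e t x ∂outcomeLaw ν A f (u e.1.1 - u e.1.2) ≤ ENNReal.ofReal (m e)) :
    ∫⁻ ω, ∏ e, ∏ t : Fin T with t.val < N e ω, h e t (X e t ω) ∂P ≤
      ∏ e, ENNReal.ofReal ((1 - p + p * m e) ^ T) := by
  classical
  set Y : Pair n × Option (Fin T) → Ω → ℝ := fun q ω =>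
    q.2.elim (N q.1 ω : ℝ) (fun t => X q.1 t ω) with hY
  have hYm : ∀ q, Measurable (Y q) := by
    rintro ⟨e, _ | t⟩
    · exact (measurable_from_top (f := fun k : ℕ => (k : ℝ))).comp (hdata.measurable_count e)
    · exact hdata.measurable_outcome e t
  -- For a prescribed vector `k` of counts, φ is the indicator of that count in the count coordinate
  -- and `h` in the first `k e` outcomes. Exactly one `k` matches almost every sample, and each term
  -- factors by independence.
  set φ : (Pair n → Fin (T + 1)) → Pair n × Option (Fin T) → ℝ → ℝ≥0∞ := fun k q x =>
    q.2.elim (Set.indicator {((k q.1 : ℕ) : ℝ)} 1 x)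
      (fun t => if t.val < k q.1 then h q.1 t x else 1) with hφ
  have hφm : ∀ k q, Measurable (φ k q) := by
    rintro k ⟨e, _ | t⟩
    · exact measurable_one.indicator (measurableSet_singleton _)
    · by_cases ht : t.val < k e
      · simpa [φ, ht] using hh e t
      · simp [φ, ht]
  have hφY : ∀ k q, Measurable fun ω => φ k q (Y q ω) := fun k q => (hφm k q).comp (hYm q)
  have hsplit : ∀ᵐ ω ∂P, ∏ e, ∏ t : Fin T with t.val < N e ω, h e t (X e t ω) =
      ∑ k, ∏ q, φ k q (Y q ω) := by
    filter_upwards [hdata.ae_count_le] with ω hω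
    rw [Finset.sum_eq_single (fun e => ⟨N e ω, Nat.lt_succ_of_le (hω e)⟩)]
    · simp only [Fintype.prod_prod_type, Fintype.prod_option, φ, Y, Option.elim_none,
        Option.elim_some, Finset.prod_filter]
      simp
    · intro k _ hk
      obtain ⟨e, he⟩ := Function.ne_iff.1 hk
      refine Finset.prod_eq_zero (Finset.mem_univ (e, none)) ?_
      have : N e ω ≠ k e := fun h => he (Fin.ext h.symm)
      simp [φ, Y, this]
    · simp
  rw [lintegral_congr_ae hsplit, lintegral_finsetSum _ fun k _ =>
    Finset.measurable_fun_prod _ fun q _ => hφY k q]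
  have hfactor : ∀ k, ∫⁻ ω, ∏ q, φ k q (Y q ω) ∂P ≤
      ∏ e, ENNReal.ofReal ((T.choose (k e) : ℝ) * p ^ (k e : ℕ) * (1 - p) ^ (T - k e)) *
        ENNReal.ofReal (m e) ^ (k e : ℕ) := by
    intro k
    rw [lintegral_prod_eq_prod_lintegral_of_indepFun Finset.univ
      (fun q ω => φ k q (Y q ω)) (hdata.indep.comp (φ k) (hφm k)) (hφY k),
      Fintype.prod_prod_type]
    refine Finset.prod_le_prod' fun e _ => ?_
    rw [Fintype.prod_option]
    refine mul_le_mul' (le_of_eq ?_) ?_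
    · rw [← hdata.count_law e (k e)]
      have : (fun ω => φ k (e, none) (Y (e, none) ω)) =
          Set.indicator {ω | N e ω = k e} 1 := by
        funext ω
        by_cases hω : N e ω = k e <;> simp [φ, Y, hω]
      rw [this, lintegral_indicator_one]
      exact hdata.measurable_count e (measurableSet_singleton _)
    · calc ∏ t, ∫⁻ ω, φ k (e, some t) (Y (e, some t) ω) ∂P
          ≤ ∏ t : Fin T, if t.val < k e then ENNReal.ofReal (m e) else 1 := by
            refine Finset.prod_le_prod' fun t _ => ?_
            by_cases ht : t.val < k e
            · simp only [φ, Y, Option.elim_some, ht, if_true]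
              rw [← lintegral_map (hh e t) (hdata.measurable_outcome e t), hdata.outcome_law]
              exact hle e t
            · simp [φ, Y, ht]
        _ = ENNReal.ofReal (m e) ^ (k e : ℕ) := by
            rw [← Finset.prod_filter, Finset.prod_const,
              card_filter_val_lt (Nat.lt_succ_iff.1 (k e).2)]
  refine (Finset.sum_le_sum fun k _ => hfactor k).trans (le_of_eq ?_)
  rw [← Fintype.piFinset_univ, ← Finset.prod_univ_sum (fun _ => Finset.univ)
    (fun e (k : Fin (T + 1)) =>
      ENNReal.ofReal ((T.choose k : ℝ) * p ^ (k : ℕ) * (1 - p) ^ (T - k)) *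
        ENNReal.ofReal (m e) ^ (k : ℕ))]
  exact Finset.prod_congr rfl fun e _ => sum_binomial_mul_pow hp (hm e)

theorem IsComparisonData.measurable_prod_observed (hdata : IsComparisonData P ν A f T p u N X)
    {h : Pair n → Fin T → ℝ → ℝ≥0∞} (hh : ∀ e t, Measurable (h e t)) :
    Measurable fun ω => ∏ e, ∏ t : Fin T with t.val < N e ω, h e t (X e t ω) := by
  simp only [Finset.prod_filter]
  refine Finset.measurable_fun_prod _ fun e _ => Finset.measurable_fun_prod _ fun t _ => ?_
  exact Measurable.ite (hdata.measurable_count e (measurableSet_Ioi (a := t.val)))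
    ((hh e t).comp (hdata.measurable_outcome e t)) measurable_const

/-- Markov's inequality for the exponential moments of the observed outcomes. -/
theorem IsComparisonData.measure_exp_le_prod [IsProbabilityMeasure P]
    (hdata : IsComparisonData P ν A f T p u N X)
    (hp : p ∈ Set.Icc (0 : ℝ) 1) {h : Pair n → Fin T → ℝ → ℝ≥0∞} (hh : ∀ e t, Measurable (h e t))
    {r : Pair n → ℝ} (hr : ∀ e, 0 ≤ 1 + r e)
    (hle : ∀ e t, ∫⁻ x, h e t x ∂outcomeLaw ν A f (u e.1.1 - u e.1.2) ≤ ENNReal.ofReal (1 + r e))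
    (b : ℝ) :
    P {ω | ENNReal.ofReal (Real.exp b) ≤
        ∏ e, ∏ t : Fin T with t.val < N e ω, h e t (X e t ω)} ≤
      ENNReal.ofReal (Real.exp (T * p * ∑ e, r e - b)) := by
  refine (meas_ge_le_lintegral_div (hdata.measurable_prod_observed hh).aemeasurable
    (by simpa using Real.exp_pos b) ENNReal.ofReal_ne_top).trans ?_
  rw [Real.exp_sub, ENNReal.ofReal_div_of_pos (Real.exp_pos b)]
  gcongr
  refine (hdata.lintegral_prod_le hp hh hr hle).trans ?_
  have h0 : ∀ e, 0 ≤ 1 - p + p * (1 + r e) := fun e =>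
    add_nonneg (sub_nonneg.2 hp.2) (mul_nonneg hp.1 (hr e))
  rw [← ENNReal.ofReal_prod_of_nonneg fun e _ => pow_nonneg (h0 e) T, Finset.mul_sum, Real.exp_sum]
  refine ENNReal.ofReal_le_ofReal (Finset.prod_le_prod (fun e _ => pow_nonneg (h0 e) T)
    fun e _ => ?_)
  -- The binomial transform (1 + p r)^T is at most exp(T p r).
  rw [mul_assoc, Real.exp_nat_mul]
  refine pow_le_pow_left₀ (h0 e) ?_ T
  linarith [Real.add_one_le_exp (p * r e)]

end Independence

/-! ### Counting pairs and pairs of sets -/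

section Counting

variable {n : ℕ}

/-- A pair containing `i` is determined by its other end. The sum is the variance factor of one
coordinate of the gradient. -/
theorem sum_cutSign_singleton_sq_le (i : Fin n) : ∑ e : Pair n, cutSign {i} e ^ 2 ≤ n := by
  have h1 : ∀ e : Pair n, cutSign {i} e ^ 2 = if e.1.1 = i ∨ e.1.2 = i then 1 else 0 := by
    intro e
    have := e.2.ne
    unfold cutSign
    by_cases h1 : e.1.1 = i <;> by_cases h2 : e.1.2 = i <;> simp [h1, h2]
    exact this (h1.trans h2.symm)
  simp only [h1, Finset.sum_boole]
  have h2 : (Finset.univ.filter fun e : Pair n => e.1.1 = i ∨ e.1.2 = i).card ≤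
      (Finset.univ : Finset (Fin n)).card := by
    refine Finset.card_le_card_of_injOn (fun e => if e.1.1 = i then e.1.2 else e.1.1)
      (fun _ _ => Finset.mem_coe.2 (Finset.mem_univ _)) ?_
    rintro ⟨⟨a, b⟩, hab⟩ h ⟨⟨c, d⟩, hcd⟩ h'
    simp only [Finset.coe_filter, Finset.mem_univ, true_and] at h h'
    change a = i ∨ b = i at h
    change c = i ∨ d = i at h'
    change a < b at hab
    change c < d at hcd
    simp only [Subtype.mk.injEq, Prod.mk.injEq]
    grind
  rw [Finset.card_univ, Fintype.card_fin] at h2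
  exact_mod_cast h2

open Classical in
theorem card_mul_card_le_card_joins {S W : Finset (Fin n)} (hSW : Disjoint S W) :
    S.card * W.card ≤ (Finset.univ.filter fun e : Pair n => Joins S W e).card := by
  rw [← Finset.card_product]
  refine Finset.card_le_card_of_surjOn
    (fun e => if e.1.1 ∈ S then (e.1.1, e.1.2) else (e.1.2, e.1.1)) ?_
  rintro ⟨a, b⟩ hab
  simp only [Finset.coe_product, Set.mem_prod, Finset.mem_coe] at hab
  have hne : a ≠ b := fun h => Finset.disjoint_left.1 hSW hab.1 (h ▸ hab.2)
  rcases lt_or_gt_of_ne hne with h | h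
  · exact ⟨⟨(a, b), h⟩, Finset.mem_coe.2 (Finset.mem_filter.2 ⟨Finset.mem_univ _, Or.inl hab⟩),
      by simp [hab]⟩
  · exact ⟨⟨(b, a), h⟩, Finset.mem_coe.2 (Finset.mem_filter.2 ⟨Finset.mem_univ _, Or.inr hab⟩),
      by simp [Finset.disjoint_right.1 hSW hab.2]⟩

open Classical in
/-- A geometrically weighted count of the pairs of sets of subjects, the first one nonempty and the
second one at most `R` times as large. -/
theorem sum_pairs_le (hn : 0 < n) {R q : ℝ} (hz : n * Real.exp (R * Real.log n - q) ≤ 1) :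
    ∑ s : Finset (Fin n) × Finset (Fin n) with s.1.Nonempty ∧ (s.2.card : ℝ) ≤ R * s.1.card,
      Real.exp (-(q * s.1.card)) ≤ 6 * (n * Real.exp (R * Real.log n - q)) := by
  set z := Real.exp (R * Real.log n - q) with hzdef
  have hn' : (0 : ℝ) < n := by exact_mod_cast hn
  have hlog : 0 ≤ Real.log n := Real.log_nonneg (by exact_mod_cast hn)
  have hz0 : 0 < z := Real.exp_pos _
  set y : ℝ := Real.exp (-Real.log n) with hy
  have hyn : y = (n : ℝ)⁻¹ := by rw [hy, Real.exp_neg, Real.exp_log hn']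
  -- Inserting n^(R|S| - |S'|) ≥ 1 decouples the two sets: y = 1/n tames the sum over S' to (1 +
  -- 1/n)^n ≤ 3, and z = n^R exp(-q) bears the cost.
  have h1 : ∀ s : Finset (Fin n) × Finset (Fin n), (s.2.card : ℝ) ≤ R * s.1.card →
      Real.exp (-(q * s.1.card)) ≤ z ^ s.1.card * y ^ s.2.card := by
    intro s hs
    rw [hzdef, hy, ← Real.exp_nat_mul, ← Real.exp_nat_mul, ← Real.exp_add, Real.exp_le_exp]
    nlinarith [mul_nonneg (sub_nonneg.2 hs) hlog]
  have hpow : ∀ x : ℝ, ∑ S : Finset (Fin n), x ^ S.card = (x + 1) ^ n := by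
    intro x
    simpa using Fintype.sum_pow_mul_eq_add_pow (Fin n) x 1
  calc _ ≤ ∑ s : Finset (Fin n) × Finset (Fin n) with
          s.1.Nonempty ∧ (s.2.card : ℝ) ≤ R * s.1.card, z ^ s.1.card * y ^ s.2.card :=
        Finset.sum_le_sum fun s hs => h1 s (Finset.mem_filter.1 hs).2.2
    _ ≤ ∑ s ∈ (Finset.univ.erase (∅ : Finset (Fin n))) ×ˢ (Finset.univ : Finset (Finset (Fin n))),
          z ^ s.1.card * y ^ s.2.card := by
        refine Finset.sum_le_sum_of_subset_of_nonneg (fun s hs => ?_) fun s _ _ => by positivity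
        simpa [Finset.nonempty_iff_ne_empty] using (Finset.mem_filter.1 hs).2.1.ne_empty
    _ = ((z + 1) ^ n - 1) * (y + 1) ^ n := by
        rw [Finset.sum_product]
        dsimp only
        rw [← Finset.sum_mul_sum, hpow y,
          Finset.sum_erase_eq_sub (Finset.mem_univ _), hpow z]
        simp
    _ ≤ (2 * (n * z)) * 3 := by
        have h2 : (z + 1) ^ n ≤ 1 + 2 * (n * z) := by
          have h3 : (z + 1) ^ n ≤ Real.exp (n * z) := by
            rw [Real.exp_nat_mul]
            exact pow_le_pow_left₀ (by positivity) (Real.add_one_le_exp z) n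
          have h4 := (abs_le.1 (Real.abs_exp_sub_one_sub_id_le
            (by rwa [abs_of_nonneg (by positivity)] : |n * z| ≤ 1))).2
          have h5 : 0 ≤ n * z := by positivity
          nlinarith
        have h6 : (y + 1) ^ n ≤ 3 := by
          have h7 : (y + 1) ^ n ≤ Real.exp (n * y) := by
            rw [Real.exp_nat_mul]
            exact pow_le_pow_left₀ (by positivity) (Real.add_one_le_exp y) n
          rw [hyn, mul_inv_cancel₀ hn'.ne'] at h7
          rw [hyn]
          linarith [Real.exp_one_lt_d9]
        have h8 : 0 ≤ (z + 1) ^ n - 1 := sub_nonneg.2 (one_le_pow₀ (by linarith))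
        exact mul_le_mul (by linarith) h6 (by positivity) (by positivity)
    _ = _ := by ring

end Counting

/-! ### Chernoff bounds for the gradient and for cuts -/

section Tails

variable {Ω : Type*} [MeasurableSpace Ω] {P : Measure Ω} [IsProbabilityMeasure P]
  {ν : Measure ℝ} {A : Set ℝ} {f : ℝ → ℝ → ℝ} {T n : ℕ} {p : ℝ} {u : Fin n → ℝ}
  {N : Pair n → Ω → ℕ} {X : Pair n → Fin T → Ω → ℝ}

/-- A Chernoff bound for the derivative of the log-likelihood in one coordinate. -/
theorem IsComparisonData.measure_le_scoreSum_le (hf : IsValid ν A f)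
    (hconc : StrictlyLogConcave A f) (hdata : IsComparisonData P ν A f T p u N X)
    (hp : p ∈ Set.Icc (0 : ℝ) 1) {t : ℝ} (ht : 0 < t)
    (hQ : ∀ e : Pair n, ∫⁻ x, ENNReal.ofReal (Real.exp (score f x (u e.1.1 - u e.1.2) ^ 2 / t ^ 2))
      ∂outcomeLaw ν A f (u e.1.1 - u e.1.2) ≤ 2) {s : ℝ} (hs : s ^ 2 * t ^ 2 ≤ 1) (i : Fin n)
    (b : ℝ) :
    P {ω | b ≤ s * scoreSum f (fun e => N e ω) (fun e t => X e t ω) u {i}} ≤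
      ENNReal.ofReal (Real.exp (T * p * (s ^ 2 * t ^ 2 * n) - b)) := by
  have hmeas := fun e : Pair n => aemeasurable_score hf hconc (u e.1.1 - u e.1.2)
  -- The score is only almost everywhere measurable in the outcome, so measurable versions enter the
  -- moment bound.
  choose g hgm hge using hmeas
  set r : Pair n → ℝ := fun e => (s * cutSign {i} e) ^ 2 * t ^ 2 with hr
  have hr0 : ∀ e, 0 ≤ 1 + r e := fun e => by positivity
  have hsq : ∀ e : Pair n, cutSign {i} e ^ 2 ≤ 1 := by
    intro e
    unfold cutSign
    split_ifs <;> norm_num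
  have hle : ∀ (e : Pair n) (_ : Fin T),
      ∫⁻ x, ENNReal.ofReal (Real.exp (s * cutSign {i} e * g e x))
        ∂outcomeLaw ν A f (u e.1.1 - u e.1.2) ≤ ENNReal.ofReal (1 + r e) := by
    intro e _
    have := hf.isProbabilityMeasure_outcomeLaw (u e.1.1 - u e.1.2)
    obtain ⟨h1, h2⟩ := integral_score_eq_zero hf hconc ht (hQ e)
    have h3 := lintegral_exp_mul_le (aemeasurable_score hf hconc _) ht (hQ e) h1 h2
      (s := s * cutSign {i} e) (by
      rw [mul_pow]
      nlinarith [hsq e, mul_nonneg (sq_nonneg s) (sq_nonneg t)])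
    refine le_of_eq_of_le (lintegral_congr_ae ?_) h3
    filter_upwards [hge e] with x hx
    simp only [← hx]
  have hgX : ∀ᵐ ω ∂P, ∀ e t, score f (X e t ω) (u e.1.1 - u e.1.2) = g e (X e t ω) := by
    refine ae_all_iff.2 fun e => ae_all_iff.2 fun t => ?_
    have h := hge e
    rw [← hdata.outcome_law e t] at h
    exact ae_of_ae_map (hdata.measurable_outcome e t).aemeasurable h
  refine (measure_mono_ae ?_).trans ((hdata.measure_exp_le_prod hp
    (h := fun e _ x => ENNReal.ofReal (Real.exp (s * cutSign {i} e * g e x)))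
    (fun e _ => (((hgm e).const_mul _).exp).ennreal_ofReal) hr0 hle b).trans ?_)
  · filter_upwards [hgX] with ω hω hb
    change b ≤ _ at hb
    change ENNReal.ofReal (Real.exp b) ≤ _
    simp_rw [← ENNReal.ofReal_prod_of_nonneg (fun _ _ => (Real.exp_pos _).le), ← Real.exp_sum]
    rw [← ENNReal.ofReal_prod_of_nonneg (fun _ _ => (Real.exp_pos _).le), ← Real.exp_sum]
    refine ENNReal.ofReal_le_ofReal (Real.exp_le_exp.2 (hb.trans (le_of_eq ?_)))
    simp only [scoreSum, Finset.mul_sum, hω, mul_assoc]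
  · refine ENNReal.ofReal_le_ofReal (Real.exp_le_exp.2 (sub_le_sub_right ?_ _))
    refine mul_le_mul_of_nonneg_left ?_ (mul_nonneg (Nat.cast_nonneg T) hp.1)
    simp only [r, mul_pow]
    rw [← Finset.sum_mul, ← Finset.mul_sum]
    have := sum_cutSign_singleton_sq_le i
    nlinarith [mul_nonneg (sq_nonneg s) (sq_nonneg t)]

/-- A Chernoff bound for the number of comparisons between two disjoint sets. -/
theorem IsComparisonData.measure_cutCount_le (hf : IsValid ν A f)
    (hdata : IsComparisonData P ν A f T p u N X) (hp : p ∈ Set.Icc (0 : ℝ) 1) (hT : 1 ≤ T)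
    {S W : Finset (Fin n)} (hSW : Disjoint S W) (b : ℝ) :
    P {ω | (cutCount T (fun e => N e ω) S W : ℝ) ≤ b} ≤
      ENNReal.ofReal (Real.exp (b - p / 2 * (S.card * W.card))) := by
  classical
  set J : Pair n → ℝ := fun e => if Joins S W e then 1 else 0 with hJ
  have hprob := fun y => hf.isProbabilityMeasure_outcomeLaw y
  refine (measure_mono ?_).trans ((hdata.measure_exp_le_prod hp
    (h := fun e _ _ => ENNReal.ofReal (Real.exp (-J e))) (fun _ _ => measurable_const)
    (r := fun e => Real.exp (-J e) - 1) (fun e => by simpa using (Real.exp_pos _).le)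
    (fun e _ => by simp) (-b)).trans ?_)
  · intro ω hω
    change _ ≤ b at hω
    change ENNReal.ofReal (Real.exp (-b)) ≤ _
    simp_rw [← ENNReal.ofReal_prod_of_nonneg (fun _ _ => (Real.exp_pos _).le), ← Real.exp_sum]
    rw [← ENNReal.ofReal_prod_of_nonneg (fun _ _ => (Real.exp_pos _).le), ← Real.exp_sum]
    refine ENNReal.ofReal_le_ofReal (Real.exp_le_exp.2 ((neg_le_neg hω).trans (le_of_eq ?_)))
    simp only [cutCount, count, J, Finset.sum_const, nsmul_eq_mul, Finset.sum_filter]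
    push_cast
    rw [← Finset.sum_neg_distrib]
    refine Finset.sum_congr rfl fun e _ => ?_
    split_ifs <;> simp
  · refine ENNReal.ofReal_le_ofReal (Real.exp_le_exp.2 ?_)
    have h1 : ∑ e, (Real.exp (-J e) - 1) ≤ -(1 / 2) * (S.card * W.card) := by
      have h2 : ∑ e, (Real.exp (-J e) - 1) ≤ ∑ e, -(1 / 2) * J e := by
        refine Finset.sum_le_sum fun e _ => ?_
        simp only [J]
        split_ifs
        -- The rate 1/2 comes from exp(-1) - 1 ≤ -1/2.
        · linarith [Real.exp_neg_one_lt_d9]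
        · simp
      refine h2.trans ?_
      rw [← Finset.mul_sum, Finset.sum_boole]
      have h3 : (S.card : ℝ) * W.card ≤
          (Finset.univ.filter fun e : Pair n => Joins S W e).card := by
        exact_mod_cast card_mul_card_le_card_joins hSW
      linarith
    have hT' : (1 : ℝ) ≤ T := by exact_mod_cast hT
    have h4 := mul_le_mul_of_nonneg_left h1 (mul_nonneg (zero_le_one.trans hT') hp.1)
    have h5 : 0 ≤ (T - 1) * (p * ((S.card : ℝ) * W.card)) :=
      mul_nonneg (by linarith) (mul_nonneg hp.1 (by positivity))
    linarith

/-- The comparison graph expands with high probability. -/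
theorem IsComparisonData.measure_not_expands_le (hf : IsValid ν A f)
    (hdata : IsComparisonData P ν A f T p u N X) (hp : p ∈ Set.Icc (0 : ℝ) 1) (hT : 1 ≤ T)
    (hn : 0 < n) {R : ℝ} (hz : n * Real.exp (R * Real.log n - n * p / 8) ≤ 1) :
    P {ω | ¬ Expands T (fun e => N e ω) R (n * p / 8)} ≤
      ENNReal.ofReal (6 * (n * Real.exp (R * Real.log n - n * p / 8))) := by
  classical
  set F : Finset (Finset (Fin n) × Finset (Fin n)) := Finset.univ.filter fun s =>
    s.1.Nonempty ∧ (s.2.card : ℝ) ≤ R * s.1.card with hF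
  have hsub : {ω | ¬ Expands T (fun e => N e ω) R (n * p / 8)} ⊆
      ⋃ s ∈ F, {ω | s.1 ⊆ s.2 ∧ 2 * s.2.card ≤ n ∧
        (cutCount T (fun e => N e ω) s.1 s.2ᶜ : ℝ) ≤ n * p / 8 * s.1.card} := by
    intro ω hω
    change ¬ Expands T (fun e => N e ω) R (n * p / 8) at hω
    unfold Expands at hω
    push Not at hω
    obtain ⟨S, S', h1, h2, h3, h4, h5⟩ := hω
    exact Set.mem_biUnion (x := (S, S')) (by simp [F, h1, h3]) ⟨h2, h4, h5⟩
  refine (measure_mono hsub).trans ((measure_biUnion_finset_le _ _).trans ?_)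
  refine le_trans (Finset.sum_le_sum (g := fun s => ENNReal.ofReal
    (Real.exp (-(n * p / 8 * s.1.card)))) fun s _ => ?_) ?_
  · by_cases h1 : s.1 ⊆ s.2
    · by_cases h2 : 2 * s.2.card ≤ n
      · simp only [h1, h2, true_and]
        refine (hdata.measure_cutCount_le hf hp hT
          (Finset.disjoint_left.2 fun i hi hi' => Finset.mem_compl.1 hi' (h1 hi)) _).trans ?_
        refine ENNReal.ofReal_le_ofReal (Real.exp_le_exp.2 ?_)
        -- The complement holds at least half of the subjects, so the mean term is at least np|S|/4;
        -- subtracting the threshold np|S|/8 leaves np|S|/8.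
        have h3 : n ≤ 2 * s.2ᶜ.card := by
          have := Finset.card_add_card_compl s.2
          rw [Fintype.card_fin] at this
          omega
        have h3' : (n : ℝ) ≤ 2 * s.2ᶜ.card := by exact_mod_cast h3
        have h4 : 0 ≤ p * s.1.card := mul_nonneg hp.1 (Nat.cast_nonneg _)
        nlinarith
      · simp [h2]
    · simp [h1]
  · rw [← ENNReal.ofReal_sum_of_nonneg fun _ _ => (Real.exp_pos _).le]
    exact ENNReal.ofReal_le_ofReal (sum_pairs_le hn hz)

end Tails

/-! ### The finite sample bound -/

section FiniteSample

variable {Ω : Type*} [MeasurableSpace Ω] {P : Measure Ω}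
  {ν : Measure ℝ} {A : Set ℝ} {f : ℝ → ℝ → ℝ} {T n : ℕ} {p : ℝ} {u : Fin n → ℝ}
  {N : Pair n → Ω → ℕ} {X : Pair n → Fin T → Ω → ℝ}

theorem IsComparisonData.ae_mem (hf : IsValid ν A f) (hdata : IsComparisonData P ν A f T p u N X) :
    ∀ᵐ ω ∂P, ∀ e t, X e t ω ∈ A := by
  refine ae_all_iff.2 fun e => ae_all_iff.2 fun t => ?_
  have h := hf.ae_mem (u e.1.1 - u e.1.2)
  rw [← hdata.outcome_law e t] at h
  exact ae_of_ae_map (hdata.measurable_outcome e t).aemeasurable h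

variable [IsProbabilityMeasure P]

/-- Every coordinate of the gradient of the log-likelihood at the true scores is small with high
probability. -/
theorem IsComparisonData.measure_noise_le (hf : IsValid ν A f)
    (hconc : StrictlyLogConcave A f) (hdata : IsComparisonData P ν A f T p u N X)
    (hp : p ∈ Set.Icc (0 : ℝ) 1) (hn : 2 ≤ n) {t : ℝ} (ht : 0 < t)
    (hQ : ∀ e : Pair n, ∫⁻ x, ENNReal.ofReal (Real.exp (score f x (u e.1.1 - u e.1.2) ^ 2 / t ^ 2))
      ∂outcomeLaw ν A f (u e.1.1 - u e.1.2) ≤ 2) (hq : Real.log n ≤ n * p) :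
    P {ω | ¬ ∀ i, |scoreSum f (fun e => N e ω) (fun e t => X e t ω) u {i}| ≤
      (T + 3) * t * √(Real.log n * (n * p))} ≤ ENNReal.ofReal (2 / (n : ℝ) ^ 2) := by
  have hn' : (1 : ℝ) < n := by exact_mod_cast hn
  have hL : 0 < Real.log n := Real.log_pos hn'
  set L := Real.log n with hLdef
  set q := n * p with hqdef
  have hq0 : 0 < q := hL.trans_le hq
  -- With s²t² = L/q the Chernoff exponent is TL - (T+3)L = -3L. Each one-sided tail is thus n⁻³,
  -- and 2n of them sum to 2/n².
  set s : ℝ := √(L / q) / t with hs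
  have hs0 : 0 < s := by positivity
  have hst : s ^ 2 * t ^ 2 = L / q := by
    rw [hs, div_pow, Real.sq_sqrt (by positivity)]
    field_simp
  have hst1 : s ^ 2 * t ^ 2 ≤ 1 := by rw [hst]; exact (div_le_one hq0).2 hq
  have hsB : s * ((T + 3) * t * √(L * q)) = (T + 3) * L := by
    have h1 : √(L / q) * √(L * q) = L := by
      rw [← Real.sqrt_mul (by positivity)]
      have : L / q * (L * q) = L ^ 2 := by field_simp
      rw [this, Real.sqrt_sq hL.le]
    calc s * ((T + 3) * t * √(L * q)) = (T + 3) * (√(L / q) * √(L * q)) := by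
          rw [hs]; field_simp
      _ = _ := by rw [h1]
  have htail : ∀ (r : ℝ), r ^ 2 = s ^ 2 → ∀ i : Fin n,
      P {ω | (T + 3) * L ≤ r * scoreSum f (fun e => N e ω) (fun e t => X e t ω) u {i}} ≤
        ENNReal.ofReal (((n : ℝ) ^ 3)⁻¹) := by
    intro r hr i
    refine (hdata.measure_le_scoreSum_le hf hconc hp ht hQ (by rwa [hr]) i _).trans
      (le_of_eq ?_)
    congr 1
    have h2 : T * p * (r ^ 2 * t ^ 2 * n) - (T + 3) * L = -(((3 : ℕ) : ℝ) * L) := by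
      rw [hr, hst]
      have : T * p * (L / q * n) = T * L := by
        have h3 : p * (L / q * n) = L := by
          rw [show p * (L / q * n) = L / q * q by rw [hqdef]; ring, div_mul_cancel₀ _ hq0.ne']
        rw [mul_assoc, h3]
      rw [this]
      push_cast
      ring
    rw [h2, Real.exp_neg, Real.exp_nat_mul, hLdef, Real.exp_log (by linarith)]
  have hsub : {ω | ¬ ∀ i, |scoreSum f (fun e => N e ω) (fun e t => X e t ω) u {i}| ≤
      (T + 3) * t * √(L * q)} ⊆
      ⋃ i ∈ (Finset.univ : Finset (Fin n)),
        ({ω | (T + 3) * L ≤ s * scoreSum f (fun e => N e ω) (fun e t => X e t ω) u {i}} ∪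
        {ω | (T + 3) * L ≤ -s * scoreSum f (fun e => N e ω) (fun e t => X e t ω) u {i}}) := by
    intro ω hω
    rw [Set.mem_ofPred_eq] at hω
    push Not at hω
    obtain ⟨i, hi⟩ := hω
    refine Set.mem_biUnion (Finset.mem_coe.2 (Finset.mem_univ i)) ?_
    rcases lt_abs.1 hi with h | h
    · left
      rw [Set.mem_ofPred_eq, ← hsB]
      exact mul_le_mul_of_nonneg_left h.le hs0.le
    · right
      rw [Set.mem_ofPred_eq, ← hsB, neg_mul, ← mul_neg]
      exact mul_le_mul_of_nonneg_left h.le hs0.le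
  refine (measure_mono hsub).trans ((measure_biUnion_finset_le _ _).trans ?_)
  refine (Finset.sum_le_sum fun i _ => (measure_union_le _ _).trans
    (add_le_add (htail s rfl i) (htail (-s) (neg_sq s) i))).trans (le_of_eq ?_)
  rw [Finset.sum_const, Finset.card_univ, Fintype.card_fin, nsmul_eq_mul,
    ← ENNReal.ofReal_add (by positivity) (by positivity), ← ENNReal.ofReal_natCast n,
    ← ENNReal.ofReal_mul (by positivity)]
  congr 1
  field_simp
  ring

/-- The finite sample form of the consistency theorem. -/
theorem IsComparisonData.measure_not_isUniqueMLE_le (hf : IsValid ν A f)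
    (hconc : StrictlyLogConcave A f) (hdata : IsComparisonData P ν A f T p u N X)
    (hp : p ∈ Set.Icc (0 : ℝ) 1) (hT : 1 ≤ T) (hn : 2 ≤ n) (hu : u ∈ paramSpace n)
    {c5 : ℝ≥0} (hc5 : 0 < c5) (hsubG : ∀ y : ℝ, |y| ≤ dynamicRange u →
      psi2Norm (outcomeLaw ν A f y) (fun x => score f x y) ≤ c5)
    {c4 : ℝ} (hc4 : 0 < c4)
    (hc : ∀ x ∈ A, ∀ y, |y| ≤ dynamicRange u + 1 → c4 ≤ |scoreDeriv f x y|)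
    (hq : 48 * Real.log n ≤ n * p) {K : ℕ} (hK : n ≤ (n * p / (16 * Real.log n)) ^ K) {δ : ℝ}
    (hδ : (T + 3) * (2 * c5) * √(Real.log n * (n * p)) = c4 * δ * (n * p / 8))
    (hsmall : 2 * (K * δ) < 1) :
    P {ω | ¬ ∃ v, IsUniqueMLE f (fun e => N e ω) (fun e t => X e t ω) v ∧
      ‖v - u‖ ≤ 2 * (K * δ)} ≤ ENNReal.ofReal (14 / (n : ℝ) ^ 2) := by
  have hn' : (1 : ℝ) < n := by exact_mod_cast hn
  have hL : 0 < Real.log n := Real.log_pos hn'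
  have hq0 : 0 < n * p := by linarith
  have hc5' : (0 : ℝ) < c5 := hc5
  have hδ0 : 0 < δ := by
    have h1 : 0 < (T + 3) * (2 * c5) * √(Real.log n * (n * p)) := by positivity
    rw [hδ] at h1
    exact (pos_iff_pos_of_mul_pos (pos_of_mul_pos_left h1 (by positivity))).1 hc4
  set R := n * p / (16 * Real.log n) with hR
  have hR1 : 1 ≤ R := by
    rw [hR, le_div_iff₀ (by positivity)]
    linarith
  have hRL : R * Real.log n - n * p / 8 = -(n * p / 16) := by
    rw [hR]
    field_simp
    ring
  -- The choice of R uses up half of the exponent np/8, and 48 log n ≤ np makes the other half at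
  -- least 3 log n.
  have hz : n * Real.exp (R * Real.log n - n * p / 8) ≤ 1 / (n : ℝ) ^ 2 := by
    rw [hRL]
    have h1 : Real.exp (-(n * p / 16)) ≤ Real.exp (-(((3 : ℕ) : ℝ) * Real.log n)) := by
      rw [Real.exp_le_exp]
      push_cast
      linarith
    rw [Real.exp_neg (((3 : ℕ) : ℝ) * Real.log n), Real.exp_nat_mul,
      Real.exp_log (by linarith)] at h1
    refine (mul_le_mul_of_nonneg_left h1 (by linarith)).trans (le_of_eq ?_)
    field_simp
  have hz1 : n * Real.exp (R * Real.log n - n * p / 8) ≤ 1 :=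
    hz.trans ((div_le_one (by positivity)).2 (one_le_pow₀ hn'.le))
  have hexpand := (hdata.measure_not_expands_le hf hp hT (by omega) hz1).trans
    (ENNReal.ofReal_le_ofReal (mul_le_mul_of_nonneg_left hz (by norm_num)))
  -- The factor 2 puts the scale strictly above the infimum that defines the ψ₂-norm.
  have hnoise := hdata.measure_noise_le hf hconc hp hn (t := 2 * c5) (by positivity)
    (fun e => lintegral_exp_le_of_psi2Norm_lt (by positivity)
      ((hsubG _ (abs_sub_le_dynamicRange u _ _)).trans_lt (by
        rw [← ENNReal.ofReal_coe_nnreal]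
        exact (ENNReal.ofReal_lt_ofReal_iff (by positivity)).2 (by linarith)))) (by linarith)
  refine (measure_mono_ae (t := {ω | ¬ Expands T (fun e => N e ω) R (n * p / 8)} ∪ {ω | ¬ ∀ i,
    |scoreSum f (fun e => N e ω) (fun e t => X e t ω) u {i}| ≤
      (T + 3) * (2 * c5) * √(Real.log n * (n * p))}) ?_).trans ((measure_union_le _ _).trans
    ((add_le_add hexpand hnoise).trans ?_))
  · filter_upwards [hdata.ae_mem hf] with ω hX hω
    by_contra hcon
    obtain ⟨h1, h2⟩ := not_or.1 hcon
    exact hω (exists_isUniqueMLE hconc hX (by omega) hu hc (not_not.1 h1) hR1 hc4 hδ0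
      (by positivity) hδ.le (not_not.1 h2) hK hsmall)
  · rw [← ENNReal.ofReal_add (by positivity) (by positivity)]
    refine ENNReal.ofReal_le_ofReal ?_
    rw [← mul_div_assoc, ← add_div]
    gcongr
    norm_num

end FiniteSample

/-! ### Consequences of the rate condition -/

section Rate

variable {ν : Measure ℝ} {A : Set ℝ} {f : ℝ → ℝ → ℝ}

theorem C4_ne_top (hA : A.Nonempty) {M : ℝ} (hM : 0 ≤ M) : C4 A f M ≠ ∞ := by
  obtain ⟨x, hx⟩ := hA
  refine ne_top_of_le_ne_top (ENNReal.ofReal_ne_top (r := |scoreDeriv f x 0|)) ?_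
  exact iInf₂_le_of_le x hx (iInf₂_le_of_le 0 (by rw [abs_zero]; linarith) le_rfl)

theorem C4_anti {M M' : ℝ} (h : M ≤ M') : C4 A f M' ≤ C4 A f M :=
  iInf₂_mono fun x _ => iInf_mono fun y => iInf_mono' fun hy => ⟨by linarith, le_rfl⟩

theorem C4_le_C3 (hA : A.Nonempty) {M : ℝ} (hM : 0 ≤ M) : C4 A f M ≤ C3 A f M := by
  obtain ⟨x, hx⟩ := hA
  have h0 : |(0 : ℝ)| ≤ M + 1 := by rw [abs_zero]; linarith
  exact (iInf₂_le_of_le x hx (iInf₂_le_of_le 0 h0 le_rfl)).trans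
    (le_iSup₂_of_le x hx (le_iSup₂_of_le 0 h0 le_rfl))

theorem C3_ne_zero (hA : A.Nonempty) (hconc : StrictlyLogConcave A f) {M : ℝ} (hM : 0 ≤ M) :
    C3 A f M ≠ 0 := by
  obtain ⟨x, hx⟩ := hA
  have h0 : |(0 : ℝ)| ≤ M + 1 := by rw [abs_zero]; linarith
  have h1 : 0 < ENNReal.ofReal |scoreDeriv f x 0| :=
    ENNReal.ofReal_pos.2 (abs_pos.2 (hconc.scoreDeriv_neg x hx 0).ne)
  have h2 : ENNReal.ofReal |scoreDeriv f x 0| ≤ C3 A f M :=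
    le_iSup₂_of_le (f := fun x _ => ⨆ (y : ℝ) (_ : |y| ≤ M + 1), ENNReal.ofReal |scoreDeriv f x y|)
      x hx (le_iSup₂_of_le (f := fun y _ => ENNReal.ofReal |scoreDeriv f x y|) 0 h0 le_rfl)
  exact (h1.trans_le h2).ne'

theorem toReal_C4_le {M : ℝ} {x y : ℝ} (hx : x ∈ A) (hy : |y| ≤ M + 1) :
    (C4 A f M).toReal ≤ |scoreDeriv f x y| :=
  ENNReal.toReal_le_of_le_ofReal (abs_nonneg _) (iInf₂_le_of_le x hx (iInf₂_le_of_le y hy le_rfl))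

/-- The factor of the rate that depends only on the graph. -/
def graphRate (n : ℕ) (p : ℝ) : ℝ := √(Real.log n / (n * p)) * (Real.log n / Real.log (n * p))

/-- The argument needs only the factor C⁽⁵⁾/C⁽⁴⁾, which C⁽⁴⁾ ≤ C⁽³⁾ compares with Δ. If C⁽⁴⁾ = 0,
the numerator of Δ is nonzero and the bound is infinite. -/
theorem div_mul_le_Delta (hA : A.Nonempty) (hconc : StrictlyLogConcave A f) {M : ℝ} (hM : 0 ≤ M)
    {c5 : ℝ≥0} (hc5 : c5 ≠ 0) (n : ℕ) (p : ℝ) :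
    c5 / C4 A f M * ENNReal.ofReal (graphRate n p) ≤ Delta A f n M p c5 := by
  suffices h : (c5 : ℝ≥0∞) / C4 A f M ≤ C3 A f M * c5 / C4 A f M ^ 2 from
    mul_le_mul_left h (ENNReal.ofReal (graphRate n p))
  by_cases h0 : C4 A f M = 0
  · rw [h0, zero_pow two_ne_zero,
      ENNReal.div_zero (mul_ne_zero (C3_ne_zero hA hconc hM) (ENNReal.coe_ne_zero.2 hc5))]
    exact le_top
  · have htop := C4_ne_top (f := f) hA hM
    calc (c5 : ℝ≥0∞) / C4 A f M = C4 A f M * c5 / C4 A f M ^ 2 := by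
          rw [pow_two, ENNReal.mul_div_mul_left _ _ h0 htop]
      _ ≤ _ := by
          gcongr
          exact C4_le_C3 hA hM

/-- The constant is 16³, matching the cube of 16 log n in `sqrt_le_of_graphRate_le`. -/
theorem eventually_log_sq_le : ∀ᶠ x : ℝ in atTop, 4096 * Real.log x ^ 2 ≤ √x := by
  have h := (Real.isLittleO_pow_log_id_atTop (n := 4)).bound (c := (1 / 4096) ^ 2) (by norm_num)
  filter_upwards [h, eventually_ge_atTop 1] with x hx hx1
  simp only [id, Real.norm_eq_abs] at hx
  rw [abs_of_nonneg (by positivity), abs_of_nonneg (by linarith)] at hx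
  refine Real.le_sqrt_of_sq_le ?_
  nlinarith

/-- The growth factor is at least the square root of the expected degree. -/
theorem sqrt_le_of_graphRate_le {n : ℕ} {p : ℝ} (hn : 2 ≤ n) (hq : 1 < n * p)
    (hlog : 4096 * Real.log (n * p) ^ 2 ≤ √(n * p)) (hrate : graphRate n p ≤ 1) :
    √(n * p) ≤ n * p / (16 * Real.log n) := by
  have hL : 0 < Real.log n := Real.log_pos (by exact_mod_cast hn)
  unfold graphRate at hrate
  set L := Real.log n
  set q := n * p
  have hl : 0 < Real.log q := Real.log_pos hq
  have hq0 : 0 < q := by linarith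
  set r := √q with hr
  have hr0 : 0 < r := Real.sqrt_pos.2 hq0
  have hrq : r ^ 2 = q := Real.sq_sqrt hq0.le
  have h1 : L ^ 3 ≤ q * Real.log q ^ 2 := by
    have h2 : (√(L / q) * (L / Real.log q)) ^ 2 ≤ 1 := pow_le_one₀ (by positivity) hrate
    rw [mul_pow, Real.sq_sqrt (by positivity), div_pow, div_mul_div_comm,
      div_le_one (by positivity)] at h2
    linarith
  have h3 : (16 * L) ^ 3 ≤ r ^ 3 := by
    have : r ^ 3 = q * r := by rw [← hrq]; ring
    rw [this]
    nlinarith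
  have h4 : 16 * L ≤ r := le_of_pow_le_pow_left₀ three_ne_zero hr0.le h3
  rw [le_div_iff₀ (by positivity), ← hrq]
  nlinarith

/-- As p ≤ 1, the factor log n/log(np) is at least 1, so the square root alone is at most 1/7;
squaring gives 49 log n ≤ np. -/
theorem le_of_graphRate_le {n : ℕ} {p : ℝ} (hn : 2 ≤ n) (hq : 1 < n * p) (hp : p ≤ 1)
    (hrate : graphRate n p ≤ 1 / 7) : 48 * Real.log n ≤ n * p := by
  have hL : 0 < Real.log n := Real.log_pos (by exact_mod_cast hn)
  have hlog : Real.log (n * p) ≤ Real.log n :=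
    Real.log_le_log (by linarith) (mul_le_of_le_one_right (Nat.cast_nonneg n) hp)
  unfold graphRate at hrate
  have hl : 0 < Real.log (n * p) := Real.log_pos hq
  have hq0 : 0 < n * p := by linarith
  have h1 : √(Real.log n / (n * p)) ≤ 1 / 7 :=
    (le_mul_of_one_le_right (Real.sqrt_nonneg _) ((one_le_div hl).2 hlog)).trans hrate
  have h2 := Real.sqrt_le_left (by norm_num) |>.1 h1
  rw [div_le_iff₀ hq0] at h2
  linarith

/-- The number of steps needed to exhaust half of the subjects. -/
theorem exists_le_pow {n : ℕ} {p : ℝ} (hn : 2 ≤ n) (hq : 1 < n * p) (hp : p ≤ 1)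
    (hR : √(n * p) ≤ n * p / (16 * Real.log n)) :
    ∃ K : ℕ, n ≤ (n * p / (16 * Real.log n)) ^ K ∧ K ≤ 3 * (Real.log n / Real.log (n * p)) := by
  have hL : 0 < Real.log n := Real.log_pos (by exact_mod_cast hn)
  have hn0 : (0 : ℝ) < n := by positivity
  have hq0 : 0 < n * p := by linarith
  have hl : 0 < Real.log (n * p) := Real.log_pos hq
  have hlog : Real.log (n * p) ≤ Real.log n :=
    Real.log_le_log (by linarith) (mul_le_of_le_one_right (Nat.cast_nonneg n) hp)
  set R := n * p / (16 * Real.log n)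
  have hR0 : 0 < R := (Real.sqrt_pos.2 hq0).trans_le hR
  have h1 : Real.log (n * p) / 2 ≤ Real.log R := by
    rw [← Real.log_sqrt hq0.le]
    exact Real.log_le_log (Real.sqrt_pos.2 hq0) hR
  -- Since log R ≥ log(np)/2, this many factors R reach n; rounding up costs at most 1 ≤ log
  -- n/log(np).
  refine ⟨⌈2 * (Real.log n / Real.log (n * p))⌉₊, ?_, ?_⟩
  · rw [← Real.log_le_log_iff hn0 (by positivity), Real.log_pow]
    calc Real.log n = 2 * (Real.log n / Real.log (n * p)) * (Real.log (n * p) / 2) := by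
          field_simp
      _ ≤ _ := by
          gcongr
          exact Nat.le_ceil _
  · have h2 := (Nat.ceil_lt_add_one (by positivity : 0 ≤ 2 * (Real.log n / Real.log (n * p)))).le
    have h3 := (one_le_div hl).2 hlog
    linarith

end Rate

/-! ### From the finite sample bound to the asymptotic statement -/

section Asymptotic

variable {Ω : Type*} [MeasurableSpace Ω] {P : Measure Ω} [IsProbabilityMeasure P]
  {ν : Measure ℝ} {A : Set ℝ} {f : ℝ → ℝ → ℝ} {T : ℕ} {p : ℕ → ℝ} {u : (n : ℕ) → Fin n → ℝ}
  {N : (n : ℕ) → Pair n → Ω → ℕ} {X : (n : ℕ) → Pair n → Fin T → Ω → ℝ} {c5 : ℕ → ℝ≥0}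

theorem tendsto_mul_atTop (hp_lower : ∃ c : ℝ, 1 < c ∧ ∀ᶠ n : ℕ in atTop,
    c * (Real.log n / n) ≤ p n) : Tendsto (fun n : ℕ => n * p n) atTop atTop := by
  obtain ⟨c, hc, h⟩ := hp_lower
  refine tendsto_atTop_mono' atTop ?_ (Real.tendsto_log_atTop.comp tendsto_natCast_atTop_atTop)
  filter_upwards [h, eventually_ge_atTop 1] with n hn hn1
  have hn0 : (0 : ℝ) < n := by exact_mod_cast hn1
  have hL : 0 ≤ Real.log n := Real.log_nonneg (by exact_mod_cast hn1)
  calc Real.log n ≤ c * Real.log n := le_mul_of_one_le_left hL hc.le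
    _ = n * (c * (Real.log n / n)) := by field_simp
    _ ≤ n * p n := by gcongr

/-- The factor C⁽⁵⁾/C⁽⁴⁾ cannot vanish in the limit: y = 0 is always in range, where the score has
positive ψ₂-norm, and C⁽⁴⁾ is largest at dynamic range 0. The minimum with 1 keeps the lower bound
finite. -/
theorem tendsto_ofReal_graphRate (hf : IsValid ν A f) (hconc : StrictlyLogConcave A f)
    (hsubG : ∀ n, ∀ y : ℝ, |y| ≤ dynamicRange (u n) →
      psi2Norm (outcomeLaw ν A f y) (fun x => score f x y) ≤ c5 n)
    (hDelta : Tendsto (fun n => Delta A f n (dynamicRange (u n)) (p n) (c5 n)) atTop (𝓝 0)) :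
    Tendsto (fun n => ENNReal.ofReal (graphRate n (p n))) atTop (𝓝 0) := by
  set a : ℝ≥0∞ := min 1 (psi2Norm (outcomeLaw ν A f 0) (fun x => score f x 0) / C4 A f 0) with ha
  have hle : ∀ n, psi2Norm (outcomeLaw ν A f 0) (fun x => score f x 0) ≤ c5 n := fun n =>
    hsubG n 0 (by simpa using dynamicRange_nonneg (u n))
  have h0 := psi2Norm_score_ne_zero hf hconc 0
  have ha0 : a ≠ 0 := (lt_min one_pos
    (pos_iff_ne_zero.2 (ENNReal.div_ne_zero.2 ⟨h0, C4_ne_top hf.nonempty le_rfl⟩))).ne'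
  have hat : a ≠ ∞ := ne_top_of_le_ne_top ENNReal.one_ne_top (min_le_left _ _)
  refine tendsto_of_tendsto_of_tendsto_of_le_of_le tendsto_const_nhds
    (h := fun n => Delta A f n (dynamicRange (u n)) (p n) (c5 n) / a) ?_ (fun _ => zero_le)
    fun n => ?_
  · simpa using ENNReal.Tendsto.div_const hDelta (b := a) (Or.inr ha0)
  · have hM := dynamicRange_nonneg (u n)
    have hc5 : c5 n ≠ 0 := fun h => h0 (by simpa [h] using hle n)
    change ENNReal.ofReal (graphRate n (p n)) ≤ _ / a
    rw [ENNReal.le_div_iff_mul_le (Or.inl ha0) (Or.inl hat), mul_comm]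
    refine le_trans ?_ (div_mul_le_Delta hf.nonempty hconc hM hc5 n (p n))
    refine mul_le_mul_left ((min_le_right _ _).trans ?_) _
    exact ENNReal.div_le_div (hle n) (C4_anti hM)

/-- The consistency theorem, with a bound for the outer measure of the exceptional set. Existence of
the estimator needs no assumption on the global discrepancy: under the curvature bound the
maximizer over `nearSpace (u n)` lies in its interior, so by concavity it is a global one. -/
theorem eventually_measure_not_isUniqueMLE_le (hf : IsValid ν A f)
    (hconc : StrictlyLogConcave A f) (hT : 1 ≤ T) (hp : ∀ n, p n ∈ Set.Icc (0 : ℝ) 1)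
    (hp_lower : ∃ c : ℝ, 1 < c ∧ ∀ᶠ n : ℕ in atTop, c * (Real.log n / n) ≤ p n)
    (hu : ∀ n, u n ∈ paramSpace n)
    (hdata : ∀ n, IsComparisonData P ν A f T (p n) (u n) (N n) (X n))
    (hsubG : ∀ n, ∀ y : ℝ, |y| ≤ dynamicRange (u n) →
      psi2Norm (outcomeLaw ν A f y) (fun x => score f x y) ≤ c5 n)
    (hDelta : Tendsto (fun n => Delta A f n (dynamicRange (u n)) (p n) (c5 n)) atTop (𝓝 0)) :
    ∃ C : ℝ≥0, ∀ᶠ n : ℕ in atTop,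
      P {ω | ¬ ∃ v : Fin n → ℝ, IsUniqueMLE f (fun e => N n e ω) (fun e t => X n e t ω) v ∧
        ENNReal.ofReal ‖v - u n‖ ≤ C * Delta A f n (dynamicRange (u n)) (p n) (c5 n)} ≤
      ENNReal.ofReal (14 / (n : ℝ) ^ 2) := by
  -- 96 = 2 · 3 · 16: two sides of the oscillation, K ≤ 3 log n/log(np), and the factor 16 in δ.
  refine ⟨96 * (T + 3), ?_⟩
  have hq := tendsto_mul_atTop hp_lower
  have hrate := (tendsto_ofReal_graphRate hf hconc hsubG hDelta).eventually
    (gt_mem_nhds (show 0 < ENNReal.ofReal (1 / 7) by simp))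
  have hCD : Tendsto (fun n => ((96 * (T + 3) : ℝ≥0) : ℝ≥0∞) *
      Delta A f n (dynamicRange (u n)) (p n) (c5 n)) atTop (𝓝 0) := by
    simpa using ENNReal.Tendsto.const_mul hDelta (a := ((96 * (T + 3) : ℝ≥0) : ℝ≥0∞))
      (Or.inr ENNReal.coe_ne_top)
  filter_upwards [hrate, hCD.eventually (gt_mem_nhds one_pos), hq.eventually_gt_atTop 1,
    hq.eventually eventually_log_sq_le, eventually_ge_atTop 2] with n hrate hsmall hq1 hlog hn
  have hrate' : graphRate n (p n) ≤ 1 / 7 :=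
    ((ENNReal.ofReal_lt_ofReal_iff (by norm_num)).1 hrate).le
  obtain ⟨K, hK, hK'⟩ := exists_le_pow hn hq1 (hp n).2
    (sqrt_le_of_graphRate_le hn hq1 hlog (hrate'.trans (by norm_num)))
  have hM := dynamicRange_nonneg (u n)
  have hL : 0 < Real.log n := Real.log_pos (by exact_mod_cast hn)
  have hq0 : 0 < n * p n := by linarith
  have hl : 0 < Real.log (n * p n) := Real.log_pos hq1
  have hrate0 : 0 < graphRate n (p n) := by unfold graphRate; positivity
  have hc5 : c5 n ≠ 0 := fun h => psi2Norm_score_ne_zero hf hconc 0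
    (by simpa [h] using hsubG n 0 (by simpa using hM))
  have hc5' : 0 < c5 n := pos_iff_ne_zero.2 hc5
  have hle := div_mul_le_Delta hf.nonempty hconc hM hc5 n (p n)
  have hC4top := C4_ne_top (f := f) hf.nonempty hM
  have hC4 : C4 A f (dynamicRange (u n)) ≠ 0 := by
    intro h0
    rw [h0, ENNReal.div_zero (by simpa using hc5),
      ENNReal.top_mul (by simpa using hrate0), top_le_iff] at hle
    rw [hle, ENNReal.mul_top (by simp)] at hsmall
    exact not_top_lt hsmall
  set c4 := (C4 A f (dynamicRange (u n))).toReal with hc4def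
  have hc4 : 0 < c4 := ENNReal.toReal_pos hC4 hC4top
  have hle' : ENNReal.ofReal (c5 n / c4 * graphRate n (p n)) ≤
      Delta A f n (dynamicRange (u n)) (p n) (c5 n) := by
    refine le_of_eq_of_le ?_ hle
    rw [ENNReal.ofReal_mul (by positivity), ENNReal.ofReal_div_of_pos hc4,
      ENNReal.ofReal_coe_nnreal, hc4def, ENNReal.ofReal_toReal hC4top]
  -- The solution of B = c4 δ κ for the noise level B and κ = np/8.
  set δ : ℝ := 8 * ((T + 3) * (2 * c5 n) * √(Real.log n * (n * p n))) / (c4 * (n * p n)) with hδdef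
  have hδ0 : 0 ≤ δ := by positivity
  have hbound : 2 * (K * δ) ≤ 96 * (T + 3) * (c5 n / c4 * graphRate n (p n)) := by
    have hsqrt : √(Real.log n * (n * p n)) = √(Real.log n / (n * p n)) * (n * p n) := by
      have h1 : Real.log n * (n * p n) = Real.log n / (n * p n) * (n * p n) ^ 2 := by field_simp
      rw [h1, Real.sqrt_mul (by positivity), Real.sqrt_sq hq0.le]
    have hδ' : δ = 16 * (T + 3) * (c5 n / c4) * √(Real.log n / (n * p n)) := by
      rw [hδdef, hsqrt, div_eq_iff (by positivity)]
      field_simp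
      ring
    calc 2 * (K * δ) ≤ 2 * (3 * (Real.log n / Real.log (n * p n)) * δ) := by gcongr
      _ = _ := by
        rw [hδ', graphRate]
        ring
  have hfinal : ENNReal.ofReal (2 * (K * δ)) ≤ ((96 * (T + 3) : ℝ≥0) : ℝ≥0∞) *
      Delta A f n (dynamicRange (u n)) (p n) (c5 n) := by
    refine (ENNReal.ofReal_le_ofReal hbound).trans ?_
    rw [ENNReal.ofReal_mul (by positivity)]
    refine mul_le_mul' (le_of_eq ?_) hle'
    rw [← ENNReal.ofReal_coe_nnreal]
    push_cast
    rfl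
  have hlt : 2 * (K * δ) < 1 := ENNReal.ofReal_lt_one.1 (hfinal.trans_lt hsmall)
  refine (measure_mono fun ω hω => ?_).trans ((hdata n).measure_not_isUniqueMLE_le hf hconc (hp n)
    hT hn (hu n) hc5' (hsubG n) hc4 (fun x hx y hy => toReal_C4_le hx hy)
    (le_of_graphRate_le hn hq1 (hp n).2 hrate') hK (δ := δ) ?_ hlt)
  · rintro ⟨v, hv, hvn⟩
    exact hω ⟨v, hv, (ENNReal.ofReal_le_ofReal hvn).trans hfinal⟩
  · rw [hδdef]
    generalize (n : ℝ) * p n = q at hq0 ⊢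
    field_simp

end Asymptotic

end PairwiseComparison

end

/-! ### The theorem: high probability event and Borel–Cantelli -/

theorem mainTheorem2
    {Ω : Type*} [MeasurableSpace Ω] (P : Measure Ω) [IsProbabilityMeasure P]
    (ν : Measure ℝ) (A : Set ℝ) (f : ℝ → ℝ → ℝ)
    (hf : IsValid ν A f) (hconc : StrictlyLogConcave A f)
    (T : ℕ) (hT : 1 ≤ T)
    (p : ℕ → ℝ) (hp : ∀ n, p n ∈ Set.Icc (0 : ℝ) 1)
    (hp_lower : ∃ c : ℝ, 1 < c ∧ ∀ᶠ n : ℕ in atTop, c * (Real.log n / n) ≤ p n)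
    (u : (n : ℕ) → Fin n → ℝ) (hu : ∀ n, u n ∈ paramSpace n)
    (N : (n : ℕ) → Pair n → Ω → ℕ) (X : (n : ℕ) → Pair n → Fin T → Ω → ℝ)
    (hdata : ∀ n, IsComparisonData P ν A f T (p n) (u n) (N n) (X n))
    (c5 : ℕ → ℝ≥0)
    (hsubG : ∀ n, ∀ y : ℝ, |y| ≤ dynamicRange (u n) →
      psi2Norm (outcomeLaw ν A f y) (fun x => score f x y) ≤ c5 n)
    (hDelta : Tendsto (fun n => Delta A f n (dynamicRange (u n)) (p n) (c5 n)) atTop (𝓝 0))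
    (hexist : Tendsto (fun n : ℕ =>
      Real.log n / (n * p n * |Real.log (C1 ν A f (dynamicRange (u n)))|)) atTop (𝓝 0)) :
    (∃ K : ℝ≥0, ∀ᶠ n : ℕ in atTop,
      ∃ E : Set Ω, MeasurableSet E ∧ 1 - 14 / (n : ℝ) ^ 2 ≤ P.real E ∧
        ∀ ω ∈ E, ∃ v : Fin n → ℝ,
          IsUniqueMLE f (fun e => N n e ω) (fun e t => X n e t ω) v ∧
          ENNReal.ofReal ‖v - u n‖ ≤ K * Delta A f n (dynamicRange (u n)) (p n) (c5 n)) ∧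
    (∀ᵐ ω ∂P, ∃ v : (n : ℕ) → Fin n → ℝ,
      (∀ᶠ n in atTop, IsUniqueMLE f (fun e => N n e ω) (fun e t => X n e t ω) (v n)) ∧
      Tendsto (fun n => ‖v n - u n‖) atTop (𝓝 0)) := by
  obtain ⟨C, hC⟩ := eventually_measure_not_isUniqueMLE_le hf hconc hT hp hp_lower hu hdata hsubG
    hDelta
  refine ⟨⟨C, ?_⟩, ?_⟩
  · filter_upwards [hC, eventually_ge_atTop 1] with n hn hn1
    set bad := {ω | ¬ ∃ v : Fin n → ℝ, IsUniqueMLE f (fun e => N n e ω) (fun e t => X n e t ω) v ∧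
      ENNReal.ofReal ‖v - u n‖ ≤ C * Delta A f n (dynamicRange (u n)) (p n) (c5 n)}
    -- The bad set need not be measurable, so its measurable hull, of equal outer measure, is
    -- removed.
    refine ⟨(toMeasurable P bad)ᶜ, (measurableSet_toMeasurable P bad).compl, ?_, fun ω hω => ?_⟩
    · rw [probReal_compl_eq_one_sub (measurableSet_toMeasurable P bad)]
      refine sub_le_sub_left ?_ 1
      rw [Measure.real, measure_toMeasurable]
      exact ENNReal.toReal_le_of_le_ofReal (by positivity) hn
    · exact not_not.1 fun h => hω (subset_toMeasurable P bad h)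
  · obtain ⟨n₀, hn₀⟩ := eventually_atTop.1 hC
    have hsum : ∑' k, P {ω | ¬ ∃ v : Fin (k + n₀) → ℝ,
        IsUniqueMLE f (fun e => N (k + n₀) e ω) (fun e t => X (k + n₀) e t ω) v ∧
        ENNReal.ofReal ‖v - u (k + n₀)‖ ≤ C *
          Delta A f (k + n₀) (dynamicRange (u (k + n₀))) (p (k + n₀)) (c5 (k + n₀))} ≠ ∞ := by
      refine ne_top_of_le_ne_top ?_ (ENNReal.tsum_le_tsum fun k => hn₀ (k + n₀) (by omega))
      have hs : Summable fun n : ℕ => 14 / (n : ℝ) ^ 2 := by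
        simpa [div_eq_mul_inv] using
          (Real.summable_nat_pow_inv.2 one_lt_two).mul_left 14
      exact ((summable_nat_add_iff n₀).2 hs).tsum_ofReal_ne_top
    filter_upwards [ae_eventually_notMem hsum] with ω hω
    have hgood : ∀ᶠ n in atTop, ∃ v : Fin n → ℝ,
        IsUniqueMLE f (fun e => N n e ω) (fun e t => X n e t ω) v ∧
        ENNReal.ofReal ‖v - u n‖ ≤ C * Delta A f n (dynamicRange (u n)) (p n) (c5 n) := by
      obtain ⟨k₀, hk₀⟩ := eventually_atTop.1 hω
      refine eventually_atTop.2 ⟨k₀ + n₀, fun n hn => ?_⟩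
      obtain ⟨k, rfl⟩ : ∃ k, n = k + n₀ := ⟨n - n₀, by omega⟩
      exact not_not.1 (hk₀ k (by omega))
    -- The finitely many bad `n` receive the value 0, so one sequence is defined for all `n`.
    have hchoice : ∀ n, ∃ v : Fin n → ℝ, (∃ v : Fin n → ℝ,
        IsUniqueMLE f (fun e => N n e ω) (fun e t => X n e t ω) v ∧
        ENNReal.ofReal ‖v - u n‖ ≤ C * Delta A f n (dynamicRange (u n)) (p n) (c5 n)) →
        IsUniqueMLE f (fun e => N n e ω) (fun e t => X n e t ω) v ∧
        ENNReal.ofReal ‖v - u n‖ ≤ C * Delta A f n (dynamicRange (u n)) (p n) (c5 n) := by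
      intro n
      by_cases h : ∃ v : Fin n → ℝ, IsUniqueMLE f (fun e => N n e ω) (fun e t => X n e t ω) v ∧
          ENNReal.ofReal ‖v - u n‖ ≤ C * Delta A f n (dynamicRange (u n)) (p n) (c5 n)
      · exact ⟨h.choose, fun _ => h.choose_spec⟩
      · exact ⟨0, fun h' => absurd h' h⟩
    choose v hv using hchoice
    refine ⟨v, hgood.mono fun n hn => (hv n hn).1, ?_⟩
    have hCD : Tendsto (fun n => (C : ℝ≥0∞) * Delta A f n (dynamicRange (u n)) (p n) (c5 n)) atTop
        (𝓝 0) := by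
      simpa using ENNReal.Tendsto.const_mul hDelta (a := (C : ℝ≥0∞)) (Or.inr ENNReal.coe_ne_top)
    have hlim := tendsto_of_tendsto_of_tendsto_of_le_of_le' tendsto_const_nhds hCD
      (Eventually.of_forall fun _ => zero_le) (hgood.mono fun n hn => (hv n hn).2)
    have := (ENNReal.tendsto_toReal ENNReal.zero_ne_top).comp hlim
    simpa [Function.comp_def, ENNReal.toReal_ofReal] using this
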